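/- Let $n,m\ge 0$ be integers, let $X$ be a metric space, let $A\subset\mathbb R^{n+m}$ be a Lebesgue measurable set of positive Lebesgue measure, and let $f:A\to X$ be a Lipschitz map. Let $\omega_n$ be the volume of the unit ball of $\mathbb R^n$. For $E\subset X$ let $$\mathcal H^n_\infty(E)=\inf\Big\{\frac{\omega_n}{2^n}\sum_{i=1}^\infty(\operatorname{diam}A_i)^n:\ E\subset\bigcup_{i=1}^\infty A_i\Big\}$$ be the Hausdorff content (empty sets $A_i$ contribute $0$), let $\mathcal H^n$ be the $n$-dimensional Hausdorff measure, and for $x\in A$ let $$\Theta^{*n}(f,x)=\limsup_{r\to0^+}\frac{\mathcal H^n_\infty\big(f(B(x,r)\cap A)\big)}{\omega_n r^n}.$$ Suppose that $\Theta^{*n}(f,x)>0$ on a subset of $A$ of positive Lebesgue measure. Then: (A) $\mathcal H^n(f(A))>0$. (B) There are a Lebesgue measurable set $K\subset A$ of positive Lebesgue measure, an open set $U\supset K$, a bi-Lipschitz $C^1$-diffeomorphism $G:U\to G(U)\subset\mathbb R^{n+m}$, and a $\sqrt n$-Lipschitz map $\pi:X\to\mathbb R^n$ (with the Euclidean norm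 on $\mathbb R^n$) such that $$(\pi\circ f\circ G^{-1})(x,y)=x\qquad\text{for all }(x,y)\in G(K)\subset\mathbb R^n\times\mathbb R^m.$$ Moreover, with the same $K$ and $G$, the map $F=f\circ G^{-1}$ defined on $G(K)$ satisfies: (C) $F^{-1}(F(x,y))\cap G(K)\subset\{x\}\times\mathbb R^m$ for every $(x,y)\in G(K)$. (D) For every $y\in\mathbb R^m$, the restriction of $F$ to $(\mathbb R^n\times\{y\})\cap G(K)$ is bi-Lipschitz, i.e. there is $\Lambda>0$ (possibly depending on $y$) with $\Lambda^{-1}|p-q|\le d(F(p),F(q))\le\Lambda|p-q|$ for all $p,q$ in that set. -/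

import Mathlib

open MeasureTheory Set Filter Topology
open scoped ENNReal NNReal

noncomputable section

namespace MetricIFT

/-- The volume `ω_n` of the unit ball of `ℝⁿ`. -/
def unitBallVolume (n : ℕ) : ℝ≥0∞ :=
  volume (Metric.ball (0 : EuclideanSpace ℝ (Fin n)) 1)

/-- The Hausdorff content `H^n_∞(E) = inf (ω_n / 2^n) ∑ (diam A_i)^n` over countable coverings
of `E`. Empty members of a covering contribute `0` (this only matters for `n = 0`). -/
def hausdorffContent {X : Type*} [MetricSpace X] (n : ℕ) (E : Set X) : ℝ≥0∞ :=
  unitBallVolume n / 2 ^ n *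
    ⨅ (t : ℕ → Set X) (_ : E ⊆ ⋃ i, t i),
      ∑' i, ⨆ (_ : (t i).Nonempty), Metric.ediam (t i) ^ n

/-- The `n`-dimensional Hausdorff measure of `E`, normalized so that it agrees with Lebesgue
measure on `ℝⁿ`. -/
def normalizedHausdorff {X : Type*} [MetricSpace X] [MeasurableSpace X] [BorelSpace X]
    (n : ℕ) (E : Set X) : ℝ≥0∞ :=
  unitBallVolume n / 2 ^ n * Measure.hausdorffMeasure (n : ℝ) E

/-- The upper `n`-density `Θ^{*n}(f, x)` at `x` of the map `f` with domain `A`; it depends only on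
the values of `f` on `A`. -/
def upperDensity {X : Type*} [MetricSpace X] {k : ℕ} (n : ℕ)
    (A : Set (EuclideanSpace ℝ (Fin k))) (f : EuclideanSpace ℝ (Fin k) → X)
    (x : EuclideanSpace ℝ (Fin k)) : ℝ≥0∞ :=
  limsup (fun r : ℝ => hausdorffContent n (f '' (Metric.ball x r ∩ A)) /
    (unitBallVolume n * ENNReal.ofReal r ^ n)) (𝓝[>] 0)

/-- `f` is bi-Lipschitz on `s`. -/
def IsBiLipschitzOn {Y Z : Type*} [MetricSpace Y] [MetricSpace Z] (f : Y → Z) (s : Set Y) : Prop :=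
  ∃ Λ : ℝ, 0 < Λ ∧ ∀ x ∈ s, ∀ y ∈ s,
    Λ⁻¹ * dist x y ≤ dist (f x) (f y) ∧ dist (f x) (f y) ≤ Λ * dist x y

/-- The projection of `ℝ^{n+m}` onto the first `n` coordinates, `(x, y) ↦ x`. -/
def projFirst {n m : ℕ} (z : EuclideanSpace ℝ (Fin (n + m))) : EuclideanSpace ℝ (Fin n) :=
  WithLp.toLp 2 fun i => z (Fin.castAdd m i)

/-- The projection of `ℝ^{n+m}` onto the last `m` coordinates, `(x, y) ↦ y`. -/
def projLast {n m : ℕ} (z : EuclideanSpace ℝ (Fin (n + m))) : EuclideanSpace ℝ (Fin m) :=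
  WithLp.toLp 2 fun j => z (Fin.natAdd n j)

/-- `G` is a bi-Lipschitz `C¹`-diffeomorphism from the open set `G.source` onto its (open) image
`G.target`. -/
def IsBiLipschitzC1Diffeo {k : ℕ}
    (G : OpenPartialHomeomorph (EuclideanSpace ℝ (Fin k)) (EuclideanSpace ℝ (Fin k))) : Prop :=
  ContDiffOn ℝ 1 G G.source ∧ ContDiffOn ℝ 1 G.symm G.target ∧ IsBiLipschitzOn G G.source

end MetricIFT

end

/-! Record `f` through the distances `φ i` from `f` to a dense sequence of image points, as in the
Fréchet embedding into `ℓ^∞`. These are Lipschitz real functions, and together they control all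
distances in `f(A)`.

The core is a dichotomy valid at almost every `x`: either `n` of the derivatives `Dφ i (x)` are
independent, or the upper `n`-density vanishes. If the gradients span a space `W` of dimension `d <
n`, all the derivatives vanish on `Wᗮ`. At a Lebesgue point of the directional suprema `sup_i |∂_v φ
i|`, they are then small on average near `x`, uniformly in `i`. Mollifying at a small multiple of
`r` turns this into `|φ i y - φ i z| ≤ ε r` whenever `y - z ∈ Wᗮ` (`eventually_forall_abs_sub_le`).
A grid of mesh `r / M` in `W` thus covers `f(B(x,r) ∩ A)` by about `M^d` sets of diameter about `r /
M`. The content is at most a constant times `r^n / M`, with `M` arbitrary (`upperDensity_eq_zero`).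

Positive density therefore gives, after a countable choice, one `n`-tuple of the `φ i` with
independent derivatives on a set of positive measure. By Egorov and Whitney these functions agree
with `C¹` functions on a smaller set of positive measure. Completing them by linear coordinates, the
inverse function theorem gives `G`. The map `π` consists of the `n` corresponding distance functions
on `X`, so `π ∘ f ∘ G⁻¹` is the projection by construction. The projection of `G(K)` has positive
measure, which gives (A), while (C) and (D) follow from the identity for `π` and its Lipschitz
bound. -/

namespace MetricIFT

/-! ### Mollification of Lipschitz functions. -/

section Mollification

lemma norm_smul_lt_of_norm_lt_one {E : Type*} [NormedAddCommGroup E] [NormedSpace ℝ E]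
    {s : ℝ} (hs : 0 < s) {t : E} (ht : ‖t‖ < 1) : ‖s • t‖ < s := by
  rw [norm_smul, Real.norm_eq_abs, abs_of_pos hs]
  nlinarith

variable {E : Type*} [NormedAddCommGroup E] [InnerProductSpace ℝ E] [FiniteDimensional ℝ E]
  [MeasurableSpace E] [BorelSpace E]

/-- A bump function on the unit ball. -/
noncomputable def unitBump (E : Type*) [NormedAddCommGroup E] [InnerProductSpace ℝ E]
    [FiniteDimensional ℝ E] : ContDiffBump (0 : E) :=
  ⟨1 / 2, 1, by norm_num, by norm_num⟩

/-- The standard even mollifier, supported in the unit ball. -/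
noncomputable def mollifier (E : Type*) [NormedAddCommGroup E] [InnerProductSpace ℝ E]
    [FiniteDimensional ℝ E] [MeasurableSpace E] [BorelSpace E] : E → ℝ :=
  (unitBump E).normed volume

/-- The mollification of `g` at scale `s`. -/
noncomputable def mollify (s : ℝ) (g : E → ℝ) (x : E) : ℝ :=
  ∫ t, mollifier E t * g (x - s • t)

lemma mollifier_nonneg (t : E) : 0 ≤ mollifier E t := (unitBump E).nonneg_normed t

lemma continuous_mollifier : Continuous (mollifier E) := (unitBump E).continuous_normed

lemma contDiff_mollifier : ContDiff ℝ 1 (mollifier E) :=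
  (unitBump E).contDiff_normed (n := 1)

lemma hasCompactSupport_mollifier : HasCompactSupport (mollifier E) :=
  (unitBump E).hasCompactSupport_normed

lemma integral_mollifier : ∫ t, mollifier E t = 1 := (unitBump E).integral_normed

lemma mollifier_neg (t : E) : mollifier E (-t) = mollifier E t := (unitBump E).normed_neg t

lemma mollifier_eq_zero {t : E} (ht : 1 ≤ ‖t‖) : mollifier E t = 0 := by
  have h : t ∉ Function.support (mollifier E) := by
    rw [mollifier, ContDiffBump.support_normed_eq]
    simpa [unitBump] using ht
  simpa using h

lemma integrable_mollifier_mul {g : E → ℝ} (hg : Continuous g) :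
    Integrable (fun t => mollifier E t * g t) :=
  (continuous_mollifier.mul hg).integrable_of_hasCompactSupport
    hasCompactSupport_mollifier.mul_right

lemma integrable_mollify {g : E → ℝ} (hg : Continuous g) (s : ℝ) (x : E) :
    Integrable (fun t => mollifier E t * g (x - s • t)) :=
  integrable_mollifier_mul (g := fun t => g (x - s • t)) (by fun_prop)

lemma mollify_sub {g h : E → ℝ} (hg : Continuous g) (hh : Continuous h) (s : ℝ) (x : E) :
    mollify s (fun y => g y - h y) x = mollify s g x - mollify s h x := by
  rw [mollify, mollify, mollify, ← integral_sub (integrable_mollify hg s x)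
    (integrable_mollify hh s x)]
  simp only [mul_sub]

lemma mollify_const (s c : ℝ) (x : E) : mollify s (fun _ => c) x = c := by
  rw [mollify, integral_mul_const, integral_mollifier, one_mul]

/-- The mollifier is even, so the odd correction term integrates to zero. Affine functions are thus
unchanged by mollification, and Taylor polynomials can be subtracted freely. -/
lemma mollify_clm (s : ℝ) (l : E →L[ℝ] ℝ) (x : E) : mollify s l x = l x := by
  have hodd : ∫ t, mollifier E t * l (s • t) = 0 := by
    have h := integral_neg_eq_self (fun t : E => mollifier E t * l (s • t)) volume
    simp only [mollifier_neg, smul_neg, map_neg, mul_neg, integral_neg] at h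
    linarith
  have hi : Integrable (fun t => mollifier E t * l (s • t)) :=
    integrable_mollifier_mul (g := fun t => l (s • t)) (by fun_prop)
  have hc : Integrable (fun t => mollifier E t * l x) := integrable_mollifier_mul continuous_const
  simp only [mollify, map_sub, mul_sub]
  rw [integral_sub hc hi, hodd, integral_mul_const, integral_mollifier, one_mul, sub_zero]

/-- Mollification is a weighted average over the ball of radius `s`. -/
lemma abs_mollify_sub_le {g : E → ℝ} (hg : Continuous g) {s M c : ℝ} {x : E}
    (h : ∀ t : E, ‖t‖ < 1 → |g (x - s • t) - c| ≤ M) : |mollify s g x - c| ≤ M := by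
  have e : mollify s g x - c = ∫ t, mollifier E t * (g (x - s • t) - c) := by
    have h1 := mollify_sub hg (continuous_const (y := c)) s x
    rw [mollify_const] at h1
    exact h1.symm
  rw [e, ← Real.norm_eq_abs]
  have hM : ∫ t, mollifier E t * M = M := by
    rw [integral_mul_const, integral_mollifier, one_mul]
  refine (norm_integral_le_of_norm_le
    (integrable_mollifier_mul (g := fun _ => M) continuous_const) ?_).trans_eq hM
  refine Eventually.of_forall fun t => ?_
  rw [norm_mul, Real.norm_eq_abs, abs_of_nonneg (mollifier_nonneg t), Real.norm_eq_abs]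
  rcases lt_or_ge ‖t‖ 1 with ht | ht
  · exact mul_le_mul_of_nonneg_left (h t ht) (mollifier_nonneg t)
  · simp [mollifier_eq_zero ht]

lemma abs_mollify_sub_self_le {g : E → ℝ} {L : ℝ≥0} (hg : LipschitzWith L g) {s : ℝ} (hs : 0 < s)
    (x : E) : |mollify s g x - g x| ≤ L * s := by
  refine abs_mollify_sub_le hg.continuous fun t ht => ?_
  have h := hg.dist_le_mul (x - s • t) x
  rw [Real.dist_eq, dist_eq_norm, sub_sub_cancel_left, norm_neg] at h
  exact h.trans (mul_le_mul_of_nonneg_left (norm_smul_lt_of_norm_lt_one hs ht).le L.2)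

lemma lipschitzWith_mollify {g : E → ℝ} {L : ℝ≥0} (hg : LipschitzWith L g) (s : ℝ) :
    LipschitzWith L (mollify s g) := by
  refine LipschitzWith.of_dist_le_mul fun x y => ?_
  have hc := hg.continuous
  -- Mollification commutes with translations; the `- 0` fits the form of `abs_mollify_sub_le`.
  have e : mollify s g x - mollify s g y
      = mollify s (fun z => g z - g (z + (y - x))) x - 0 := by
    rw [mollify_sub hc (by fun_prop), sub_zero]
    congr 1
    simp only [mollify]
    congr 1 with t
    congr 2
    abel
  rw [Real.dist_eq, e]
  refine abs_mollify_sub_le (by fun_prop) fun t _ => ?_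
  have h := hg.dist_le_mul (x - s • t) (x - s • t + (y - x))
  rw [Real.dist_eq, dist_self_add_right, ← dist_eq_norm, dist_comm] at h
  simpa using h

open scoped Convolution in
lemma mollify_eq_convolution {s : ℝ} (hs : s ≠ 0) (g : E → ℝ) :
    mollify s g = fun x => (mollifier E ⋆[ContinuousLinearMap.lsmul ℝ ℝ, volume]
      (fun u => g (s • u))) (s⁻¹ • x) := by
  ext x
  simp [mollify, convolution_def, smul_sub, smul_smul, hs]

lemma contDiff_mollify {g : E → ℝ} (hg : Continuous g) {s : ℝ} (hs : s ≠ 0) :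
    ContDiff ℝ 1 (mollify s g) := by
  rw [mollify_eq_convolution hs]
  have h := hasCompactSupport_mollifier.contDiff_convolution_left (n := 1)
    (ContinuousLinearMap.lsmul ℝ ℝ) contDiff_mollifier
    (μ := (volume : Measure E)) (g := fun u => g (s • u))
    (by fun_prop : Continuous fun u => g (s • u)).locallyIntegrable
  exact (show ContDiff ℝ 1 _ from h).comp (contDiff_const_smul s⁻¹)

/-- The `L¹` norm of the gradient of the mollifier. -/
noncomputable def gradMass (E : Type*) [NormedAddCommGroup E] [InnerProductSpace ℝ E]
    [FiniteDimensional ℝ E] [MeasurableSpace E] [BorelSpace E] : ℝ :=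
  ∫ t, ‖fderiv ℝ (mollifier E) t‖

lemma gradMass_nonneg : 0 ≤ gradMass E := integral_nonneg fun _ => norm_nonneg _

/-- The derivative is put on the mollifier, so a sup bound on `g` near `z` suffices, at the cost of
a factor `1 / s`. This is harmless for Taylor remainders, which are `o(s)`. -/
lemma norm_fderiv_mollify_le {g : E → ℝ} (hg : Continuous g) {s M : ℝ} (hs : 0 < s) {z : E}
    (h : ∀ y, ‖y - z‖ ≤ s → |g y| ≤ M) :
    ‖fderiv ℝ (mollify s g) z‖ ≤ gradMass E * M / s := by
  have hl : LocallyIntegrable (fun u => g (s • u)) (volume : Measure E) :=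
    (by fun_prop : Continuous fun u => g (s • u)).locallyIntegrable
  have h1 := hasCompactSupport_mollifier.hasFDerivAt_convolution_left
    (ContinuousLinearMap.lsmul ℝ ℝ : ℝ →L[ℝ] ℝ →L[ℝ] ℝ) contDiff_mollifier hl (s⁻¹ • z)
  have h2 : HasFDerivAt (fun x : E => s⁻¹ • x) (s⁻¹ • ContinuousLinearMap.id ℝ E) z :=
    (hasFDerivAt_id z).const_smul s⁻¹
  have h3 := h1.comp z h2
  rw [mollify_eq_convolution hs.ne']
  refine h3.fderiv.symm ▸ ?_
  have hM : 0 ≤ M := (abs_nonneg _).trans (h z (by simpa using hs.le))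
  have hb : ‖(convolution (fderiv ℝ (mollifier E)) (fun u => g (s • u))
      ((ContinuousLinearMap.lsmul ℝ ℝ : ℝ →L[ℝ] ℝ →L[ℝ] ℝ).precompL E) volume) (s⁻¹ • z)‖ ≤ gradMass E * M := by
    rw [convolution_def, gradMass, ← integral_mul_const]
    have hcs := hasCompactSupport_mollifier (E := E) |>.fderiv (𝕜 := ℝ)
    have hcf := (contDiff_mollifier (E := E)).continuous_fderiv (by norm_num)
    refine norm_integral_le_of_norm_le
      ((hcf.norm.integrable_of_hasCompactSupport hcs.norm).mul_const M) ?_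
    refine Eventually.of_forall fun t => ?_
    rcases le_or_gt ‖t‖ 1 with ht | ht
    · have hp : (ContinuousLinearMap.lsmul ℝ ℝ : ℝ →L[ℝ] ℝ →L[ℝ] ℝ).precompL E
          (fderiv ℝ (mollifier E) t) (g (s • (s⁻¹ • z - t)))
          = g (s • (s⁻¹ • z - t)) • fderiv ℝ (mollifier E) t := by
        ext u
        simp [ContinuousLinearMap.precompL_apply, mul_comm]
      have hg' : ‖g (s • (s⁻¹ • z - t))‖ ≤ M := by
        rw [Real.norm_eq_abs]
        apply h
        rw [smul_sub, smul_smul, mul_inv_cancel₀ hs.ne', one_smul, sub_sub_cancel_left, norm_neg,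
          norm_smul, Real.norm_eq_abs, abs_of_pos hs]
        nlinarith
      rw [hp, norm_smul, mul_comm]
      exact mul_le_mul_of_nonneg_left hg' (norm_nonneg _)
    · have : fderiv ℝ (mollifier E) t = 0 := by
        have : t ∉ tsupport (mollifier E) := by
          rw [mollifier, ContDiffBump.tsupport_normed_eq]
          simpa [unitBump] using ht
        by_contra hne
        exact this (support_fderiv_subset ℝ (f := mollifier E) hne)
      simp [this]
  refine (ContinuousLinearMap.opNorm_comp_le _ _).trans ?_
  have h5 : ‖s⁻¹ • ContinuousLinearMap.id ℝ E‖ ≤ s⁻¹ := by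
    rw [norm_smul, Real.norm_eq_abs, abs_of_pos (inv_pos.2 hs)]
    exact mul_le_of_le_one_right (inv_pos.2 hs).le ContinuousLinearMap.norm_id_le
  rw [div_eq_mul_inv]
  exact mul_le_mul hb h5 (norm_nonneg _) (mul_nonneg gradMass_nonneg hM)

/-- Here the derivative falls on `g` instead: Rademacher makes it exist almost everywhere, and the
Lipschitz bound allows differentiation under the integral. -/
lemma hasDerivAt_mollify_line {g : E → ℝ} {L : ℝ≥0} (hg : LipschitzWith L g) {s : ℝ} (hs : s ≠ 0)
    (z v : E) : HasDerivAt (fun a : ℝ => mollify s g (z + a • v))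
      (∫ t, mollifier E t * fderiv ℝ g (z - s • t) v) 0 := by
  have hc := hg.continuous
  have hd : ∀ᵐ t : E, DifferentiableAt ℝ g (z - s • t) := by
    have h0 := hg.ae_differentiableAt (μ := (volume : Measure E))
    have hq : Measure.QuasiMeasurePreserving (fun t : E => z - s • t) volume volume := by
      have h1 : Measure.QuasiMeasurePreserving (fun t : E => s • t) volume volume := by
        refine ⟨by fun_prop, ?_⟩
        rw [Measure.map_addHaar_smul _ hs]
        exact Measure.smul_absolutelyContinuous
      exact (Measure.measurePreserving_sub_left volume z).quasiMeasurePreserving.comp h1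
    exact hq.ae h0
  have := hasDerivAt_integral_of_dominated_loc_of_lip (μ := (volume : Measure E)) (𝕜 := ℝ)
    (F := fun (a : ℝ) (t : E) => mollifier E t * g (z + a • v - s • t))
    (F' := fun t => mollifier E t * fderiv ℝ g (z - s • t) v) (x₀ := (0 : ℝ)) (s := univ)
    (bound := fun t => mollifier E t * (L * ‖v‖)) univ_mem
    (Eventually.of_forall fun a => (integrable_mollify hc s _).aestronglyMeasurable)
    (integrable_mollify hc s _)
    ?_ ?_ (integrable_mollifier_mul continuous_const) ?_
  · exact this.2
  · refine continuous_mollifier.aestronglyMeasurable.mul ?_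
    have hm := (measurable_fderiv_apply_const ℝ g v).comp
      (by fun_prop : Measurable fun t : E => z - s • t)
    exact hm.aestronglyMeasurable
  · refine Eventually.of_forall fun t => ?_
    refine LipschitzOnWith.of_dist_le_mul fun a _ b _ => ?_
    have h0 : 0 ≤ mollifier E t * (L * ‖v‖) := mul_nonneg (mollifier_nonneg t) (by positivity)
    rw [Real.coe_nnabs, abs_of_nonneg h0, dist_eq_norm, ← mul_sub, norm_mul, Real.norm_eq_abs,
      abs_of_nonneg (mollifier_nonneg t), mul_assoc, ← dist_eq_norm]
    refine mul_le_mul_of_nonneg_left ?_ (mollifier_nonneg t)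
    refine (hg.dist_le_mul _ _).trans_eq ?_
    rw [dist_sub_right, dist_add_left, dist_eq_norm, ← sub_smul, norm_smul, Real.dist_eq,
      Real.norm_eq_abs]
    ring
  · filter_upwards [hd] with t ht
    have h1 : HasDerivAt (fun a : ℝ => z + a • v - s • t) v 0 := by
      simpa using (((hasDerivAt_id (0 : ℝ)).smul_const v).const_add z).sub_const (s • t)
    have h2 : HasFDerivAt g (fderiv ℝ g (z - s • t)) (z + (0 : ℝ) • v - s • t) := by
      simpa using ht.hasFDerivAt
    exact (h2.comp_hasDerivAt (0 : ℝ) h1).const_mul _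

end Mollification

end MetricIFT

/-! ### Whitney extension from sets of uniform differentiability. -/

namespace MetricIFT

/-- `φ` is differentiable at the points of `K`, with derivative `D`, uniformly on `K`. -/
def UniformlyDifferentiableOn {E F : Type*} [NormedAddCommGroup E] [NormedSpace ℝ E]
    [NormedAddCommGroup F] [NormedSpace ℝ F] (φ : E → F) (D : E → E →L[ℝ] F) (K : Set E) : Prop :=
  ∀ ε > 0, ∃ δ > 0, ∀ x ∈ K, ∀ y, ‖y - x‖ < δ → ‖φ y - φ x - D x (y - x)‖ ≤ ε * ‖y - x‖

section Whitney

variable {E : Type*} [NormedAddCommGroup E] [InnerProductSpace ℝ E] [FiniteDimensional ℝ E]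
  [MeasurableSpace E] [BorelSpace E]

/-- After subtraction of the Taylor polynomial at `x`, only a remainder of size `o(s)` is mollified;
this gives the first two bounds. The last one says that the error has small Lipschitz constant on
`K`: nearby points use the mean value inequality, points at distance at least `s` the first bound.
-/
lemma UniformlyDifferentiableOn.mollify_approx {φ : E → ℝ} (hφ : Continuous φ)
    {D : E → E →L[ℝ] ℝ} {K : Set E} (hD : UniformlyDifferentiableOn φ D K) {ε : ℝ} (hε : 0 < ε) :
    ∃ δ > 0, ∀ s, 0 < s → s < δ →
      (∀ x ∈ K, |mollify s φ x - φ x| ≤ ε * s) ∧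
      (∀ x ∈ K, ∀ z, ‖z - x‖ < s → ‖fderiv ℝ (mollify s φ) z - D x‖ ≤ ε) ∧
      (∀ x ∈ K, ∀ y ∈ K,
        |(mollify s φ x - φ x) - (mollify s φ y - φ y)| ≤ 2 * ε * ‖x - y‖) := by
  have hC := gradMass_nonneg (E := E)
  set ε' := ε / (2 * gradMass E + 1) with hε'
  have hε'0 : 0 < ε' := by positivity
  have hε'ε : ε' ≤ ε := div_le_self hε.le (by linarith)
  have hε'2 : gradMass E * (ε' * 2) ≤ ε := by
    rw [hε', div_mul_eq_mul_div, mul_div_assoc', div_le_iff₀ (by positivity)]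
    nlinarith
  obtain ⟨δ, hδ, h⟩ := hD ε' hε'0
  refine ⟨δ / 2, by positivity, fun s hs hsδ => ?_⟩
  have ha : ∀ x ∈ K, |mollify s φ x - φ x| ≤ ε * s := by
    intro x hx
    have e : mollify s φ x - φ x
        = mollify s (fun y => φ y - D x y) x - (φ x - D x x) := by
      rw [mollify_sub hφ (D x).continuous, mollify_clm]; ring
    rw [e]
    refine abs_mollify_sub_le (by fun_prop) fun t ht => ?_
    have hn := norm_smul_lt_of_norm_lt_one hs ht
    have h1 := h x hx (x - s • t) (by rw [sub_sub_cancel_left, norm_neg]; linarith)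
    rw [sub_sub_cancel_left, norm_neg, Real.norm_eq_abs] at h1
    have e2 : φ (x - s • t) - D x (x - s • t) - (φ x - D x x)
        = φ (x - s • t) - φ x - D x (-(s • t)) := by
      simp only [map_sub, map_neg]; ring
    rw [e2]
    exact h1.trans (mul_le_mul hε'ε hn.le (norm_nonneg _) hε.le)
  have hb : ∀ x ∈ K, ∀ z, ‖z - x‖ < s → ‖fderiv ℝ (mollify s φ) z - D x‖ ≤ ε := by
    intro x hx z hz
    have e : mollify s (fun y => φ y - D x y - (φ x - D x x))
        = fun y => mollify s φ y - D x y - (φ x - D x x) := by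
      ext y
      rw [mollify_sub (by fun_prop) continuous_const, mollify_sub hφ (D x).continuous, mollify_clm,
        mollify_const]
    have hdiff : DifferentiableAt ℝ (mollify s φ) z :=
      (contDiff_mollify hφ hs.ne').differentiable (by norm_num) z
    have h2 := norm_fderiv_mollify_le (g := fun y => φ y - D x y - (φ x - D x x)) (by fun_prop)
      (M := ε' * (2 * s)) hs (z := z) ?_
    · rw [e, ((hdiff.hasFDerivAt.fun_sub (D x).hasFDerivAt).sub_const _).fderiv] at h2
      refine h2.trans ?_
      rw [div_le_iff₀ hs]
      nlinarith
    · intro y hy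
      have hyx : ‖y - x‖ < 2 * s := by
        calc ‖y - x‖ = ‖(y - z) + (z - x)‖ := by rw [sub_add_sub_cancel]
          _ ≤ ‖y - z‖ + ‖z - x‖ := norm_add_le _ _
          _ < 2 * s := by linarith
      have h1 := h x hx y (by linarith)
      have e2 : φ y - D x y - (φ x - D x x) = φ y - φ x - D x (y - x) := by
        simp only [map_sub]; ring
      rw [e2, ← Real.norm_eq_abs]
      exact h1.trans (mul_le_mul_of_nonneg_left hyx.le hε'0.le)
  refine ⟨ha, hb, fun x hx y hy => ?_⟩
  rcases lt_or_ge ‖y - x‖ s with hxy | hxy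
  · have h1 := h x hx y (by linarith)
    have h2 := (convex_ball x s).norm_image_sub_le_of_norm_hasFDerivWithin_le
      (f := fun z => mollify s φ z - D x z) (f' := fun z => fderiv ℝ (mollify s φ) z - D x)
      (C := ε) (x := x) (y := y)
      (fun z _ => (((contDiff_mollify hφ hs.ne').differentiable (by norm_num) z).hasFDerivAt.sub
        (D x).hasFDerivAt).hasFDerivWithinAt)
      (fun z hz => hb x hx z (by simpa [dist_eq_norm] using hz))
      (Metric.mem_ball_self hs) (by simpa [dist_eq_norm] using hxy)
    have e : (mollify s φ x - φ x) - (mollify s φ y - φ y)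
        = (φ y - φ x - D x (y - x)) - (mollify s φ y - D x y - (mollify s φ x - D x x)) := by
      simp only [map_sub]; ring
    rw [e, norm_sub_rev x y, ← Real.norm_eq_abs]
    refine (norm_sub_le _ _).trans ?_
    nlinarith [norm_nonneg (y - x)]
  · have h1 := abs_sub (mollify s φ x - φ x) (mollify s φ y - φ y)
    have h2 := ha x hx
    have h3 := ha y hy
    rw [norm_sub_rev x y]
    nlinarith

/-- A `C¹` function with small gradient near `K` and small Lipschitz constant on `K` agrees on `K`
with a `C¹` function whose gradient is small everywhere. -/
lemma exists_contDiff_extension_of_small_gradient {K : Set E} (hK : K.Nonempty) {η : E → ℝ}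
    (hη : ContDiff ℝ 1 η) {δ : ℝ≥0} {t : ℝ} (ht : 0 < t) (hLip : LipschitzOnWith δ η K)
    (hgrad : ∀ p ∈ K, ∀ z, ‖z - p‖ < t → ‖fderiv ℝ η z‖ ≤ δ) :
    ∃ ζ : E → ℝ, ContDiff ℝ 1 ζ ∧ EqOn ζ η K ∧ ∀ x, ‖fderiv ℝ ζ x‖ ≤ 15 * δ := by
  obtain ⟨m, hm, hmη⟩ := hLip.extend_real
  set T : ℝ≥0 := ⟨4 / t, by positivity⟩
  -- This cutoff is `1` within `t / 4` of `K` and `0` beyond `t / 2`, so mollifying at scale `t / 8`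
  -- keeps the value `1` on `K` and the value `0` at distance at least `t`.
  set c : E → ℝ := fun x => max 0 (min 1 (2 - 4 / t * Metric.infDist x K)) with hc
  have hcl : LipschitzWith T c := by
    refine LipschitzWith.const_max ?_ 0
    refine LipschitzWith.const_min ?_ 1
    refine LipschitzWith.of_dist_le_mul fun x y => ?_
    have h := (Metric.lipschitz_infDist_pt K).dist_le_mul x y
    rw [Real.dist_eq, NNReal.coe_one, one_mul] at h
    rw [Real.dist_eq, show 2 - 4 / t * Metric.infDist x K - (2 - 4 / t * Metric.infDist y K)
      = -(4 / t * (Metric.infDist x K - Metric.infDist y K)) by ring, abs_neg, abs_mul,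
      abs_of_pos (by positivity : 0 < 4 / t)]
    exact mul_le_mul_of_nonneg_left h (by positivity)
  set χ := mollify (t / 8) c with hχ
  have ht8 : 0 < t / 8 := by positivity
  have hχd : ContDiff ℝ 1 χ := contDiff_mollify hcl.continuous ht8.ne'
  have hc01 : ∀ x, 0 ≤ c x ∧ c x ≤ 1 := fun x =>
    ⟨le_max_left _ _, max_le zero_le_one (min_le_left _ _)⟩
  have hχ01 : ∀ x, 0 ≤ χ x ∧ χ x ≤ 1 := by
    intro x
    have h := abs_mollify_sub_le hcl.continuous (s := t / 8) (x := x) (c := 1 / 2) (M := 1 / 2)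
      fun u _ => by
        rw [abs_le]; constructor <;> linarith [hc01 (x - (t / 8) • u)]
    rw [abs_le] at h
    constructor <;> linarith
  have hinf : ∀ x u : E, ‖u‖ < 1 →
      |Metric.infDist (x - (t / 8) • u) K - Metric.infDist x K| ≤ t / 8 := by
    intro x u hu
    have h := (Metric.lipschitz_infDist_pt K).dist_le_mul (x - (t / 8) • u) x
    rw [Real.dist_eq, NNReal.coe_one, one_mul, dist_eq_norm, sub_sub_cancel_left, norm_neg] at h
    exact h.trans (norm_smul_lt_of_norm_lt_one ht8 hu).le
  have hχ1 : ∀ x ∈ K, χ x = 1 := by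
    intro x hx
    have h := abs_mollify_sub_le hcl.continuous (s := t / 8) (x := x) (c := 1) (M := 0) ?_
    · exact sub_eq_zero.1 (abs_nonpos_iff.1 h)
    intro u hu
    have h1 := hinf x u hu
    rw [Metric.infDist_zero_of_mem hx, sub_zero] at h1
    have h2 : 4 / t * Metric.infDist (x - (t / 8) • u) K ≤ 1 := by
      rw [div_mul_eq_mul_div, div_le_one ht]
      linarith [le_abs_self (Metric.infDist (x - (t / 8) • u) K)]
    simp only [hc]
    rw [min_eq_left (by linarith), max_eq_right zero_le_one]
    simp
  have hχ0 : ∀ x, t ≤ Metric.infDist x K → χ x = 0 := by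
    intro x hx
    have h := abs_mollify_sub_le hcl.continuous (s := t / 8) (x := x) (c := 0) (M := 0) ?_
    · simpa using h
    intro u hu
    have h1 := (abs_le.1 (hinf x u hu)).1
    have h2 : 2 ≤ 4 / t * Metric.infDist (x - (t / 8) • u) K := by
      rw [div_mul_eq_mul_div, le_div_iff₀ ht]
      linarith
    simp only [hc]
    rw [min_eq_right (by linarith), max_eq_left (by linarith)]
    simp
  set m' := mollify t m with hm'
  have hm'd : ContDiff ℝ 1 m' := contDiff_mollify hm.continuous ht.ne'
  have hm'l : ∀ x, ‖fderiv ℝ m' x‖ ≤ δ := fun x =>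
    norm_fderiv_le_of_lipschitz ℝ (lipschitzWith_mollify hm t)
  have hχl : ∀ x, ‖fderiv ℝ χ x‖ ≤ 4 / t := fun x =>
    norm_fderiv_le_of_lipschitz ℝ (C := T) (lipschitzWith_mollify hcl _)
  -- Glue `η` near `K` to the mollified Lipschitz extension `m'` away from it. Near `K` the gradient
  -- is at most `δ` from `m'`, `2δ` from `η - m'`, and `3δt · 4/t = 12δ` from the cutoff.
  refine ⟨fun x => m' x + χ x * (η x - m' x), by fun_prop, fun x hx => ?_, fun x => ?_⟩
  · simp [hχ1 x hx]
  have dm := (hm'd.differentiable (by norm_num) x).hasFDerivAt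
  have dχ := (hχd.differentiable (by norm_num) x).hasFDerivAt
  have dη := (hη.differentiable (by norm_num) x).hasFDerivAt
  rw [(dm.fun_add (dχ.fun_mul (dη.fun_sub dm))).fderiv]
  have hδ : (0 : ℝ) ≤ δ := δ.2
  rcases lt_or_ge (Metric.infDist x K) t with hx | hx
  · obtain ⟨p, hp, hpx⟩ := (Metric.infDist_lt_iff hK).1 hx
    rw [dist_eq_norm] at hpx
    have h1 : |η x - η p| ≤ δ * ‖x - p‖ := by
      have := (convex_ball p t).norm_image_sub_le_of_norm_hasFDerivWithin_le
        (f := η) (f' := fderiv ℝ η) (C := δ) (x := p) (y := x)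
        (fun z _ => (hη.differentiable (by norm_num) z).hasFDerivAt.hasFDerivWithinAt)
        (fun z hz => hgrad p hp z (by simpa [dist_eq_norm] using hz))
        (Metric.mem_ball_self ht) (by simpa [dist_eq_norm] using hpx)
      simpa using this
    have h2 : |m x - m p| ≤ δ * ‖x - p‖ := by
      have := hm.dist_le_mul x p
      rwa [Real.dist_eq, dist_eq_norm] at this
    have h3 := abs_mollify_sub_self_le hm ht x
    have h4 : |η x - m' x| ≤ 3 * (δ * t) := by
      have e : η x - m' x = (η x - η p) - (m x - m p) - (m' x - m x) := by
        rw [hmη hp]; ring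
      have h5 : (δ : ℝ) * ‖x - p‖ ≤ δ * t := mul_le_mul_of_nonneg_left hpx.le hδ
      rw [e]
      refine (abs_sub _ _).trans ?_
      have := abs_sub (η x - η p) (m x - m p)
      linarith
    have b1 : ‖χ x • (fderiv ℝ η x - fderiv ℝ m' x)‖ ≤ 1 * (δ + δ) := by
      rw [norm_smul, Real.norm_eq_abs, abs_of_nonneg (hχ01 x).1]
      exact mul_le_mul (hχ01 x).2 ((norm_sub_le _ _).trans (add_le_add (hgrad p hp x hpx) (hm'l x)))
        (norm_nonneg _) zero_le_one
    have b2 : ‖(η x - m' x) • fderiv ℝ χ x‖ ≤ 12 * δ := by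
      rw [norm_smul, Real.norm_eq_abs]
      calc _ ≤ 3 * (δ * t) * (4 / t) := mul_le_mul h4 (hχl x) (norm_nonneg _) (by positivity)
        _ = 12 * δ := by field_simp; ring
    refine (norm_add_le _ _).trans ?_
    have := norm_add_le (χ x • (fderiv ℝ η x - fderiv ℝ m' x)) ((η x - m' x) • fderiv ℝ χ x)
    have := hm'l x
    linarith
  · have h0 := hχ0 x hx
    -- The gradient of the cutoff vanishes where the cutoff attains its minimum `0`.
    have hmin : IsLocalMin χ x := Eventually.of_forall fun y => by rw [h0]; exact (hχ01 y).1
    rw [h0, hmin.fderiv_eq_zero]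
    simp only [zero_smul, smul_zero, add_zero]
    linarith [hm'l x]

/-- **Whitney extension**: a function uniformly differentiable on `K` agrees on `K` with a `C¹`
function. -/
theorem UniformlyDifferentiableOn.exists_contDiff_eqOn {φ : E → ℝ} (hφ : Continuous φ)
    {D : E → E →L[ℝ] ℝ} {K : Set E} (hD : UniformlyDifferentiableOn φ D K) :
    ∃ ψ : E → ℝ, ContDiff ℝ 1 ψ ∧ EqOn ψ φ K := by
  rcases K.eq_empty_or_nonempty with rfl | hK
  · exact ⟨0, contDiff_const, by simp⟩
  obtain ⟨x₀, hx₀⟩ := hK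
  have hpos : ∀ j : ℕ, (0 : ℝ) < (1 / 2) ^ j := fun j => by positivity
  choose d hd0 hd using fun j : ℕ => hD.mollify_approx hφ (hpos j)
  -- The scales decrease, so that points within `s (j + 1)` of `K` satisfy the gradient bounds for
  -- both `g j` and `g (j + 1)`. On `K`, `φ` is `g 0` plus the telescoping series of differences;
  -- each difference is replaced by an extension with summably small gradient.
  let s : ℕ → ℝ := fun j => Nat.rec (min (d 0 / 2) 1) (fun i r => min (d (i + 1) / 2) r) j
  have s_succ : ∀ j, s (j + 1) = min (d (j + 1) / 2) (s j) := fun _ => rfl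
  have hs0 : ∀ j, 0 < s j := by
    intro j
    induction j with
    | zero => exact lt_min (half_pos (hd0 0)) one_pos
    | succ j ih => rw [s_succ]; exact lt_min (half_pos (hd0 _)) ih
  have hsd : ∀ j, s j < d j := by
    intro j
    cases j with
    | zero => exact (min_le_left _ _).trans_lt (half_lt_self (hd0 0))
    | succ j => exact (min_le_left _ _).trans_lt (half_lt_self (hd0 _))
  have hsle : ∀ j, s (j + 1) ≤ s j := fun j => min_le_right _ _
  have hs1 : ∀ j, s j ≤ 1 := by
    intro j
    induction j with
    | zero => exact min_le_right _ _
    | succ j ih => exact (hsle j).trans ih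
  let g : ℕ → E → ℝ := fun j => mollify (s j) φ
  have hg : ∀ j, ContDiff ℝ 1 (g j) := fun j => contDiff_mollify hφ (hs0 j).ne'
  have ha : ∀ j, ∀ x ∈ K, |g j x - φ x| ≤ (1 / 2) ^ j := fun j x hx =>
    ((hd j (s j) (hs0 j) (hsd j)).1 x hx).trans (mul_le_of_le_one_right (hpos j).le (hs1 j))
  have hb := fun j => (hd j (s j) (hs0 j) (hsd j)).2.1
  have hcl := fun j => (hd j (s j) (hs0 j) (hsd j)).2.2
  -- Consecutive Lipschitz errors `2 · 2⁻ʲ` and `2 · 2⁻⁽ʲ⁺¹⁾` add up to less than `4 · 2⁻ʲ`.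
  let δ : ℕ → ℝ≥0 := fun j => 4 * (1 / 2) ^ j
  have hδ : ∀ j, (δ j : ℝ) = 4 * (1 / 2) ^ j := fun j => by simp [δ]
  have hex : ∀ j, ∃ ζ : E → ℝ, ContDiff ℝ 1 ζ ∧ EqOn ζ (fun x => g (j + 1) x - g j x) K ∧
      ∀ x, ‖fderiv ℝ ζ x‖ ≤ 15 * δ j := by
    intro j
    have hp : (1 / 2 : ℝ) ^ (j + 1) ≤ (1 / 2) ^ j := by
      rw [pow_succ]; linarith [hpos j]
    refine exists_contDiff_extension_of_small_gradient ⟨x₀, hx₀⟩ ((hg (j + 1)).sub (hg j))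
      (hs0 (j + 1)) (LipschitzOnWith.of_dist_le_mul fun x hx y hy => ?_) fun p hp' z hz => ?_
    · have h1 := hcl j x hx y hy
      have h2 := hcl (j + 1) x hx y hy
      rw [Real.dist_eq, dist_eq_norm, hδ]
      have e : g (j + 1) x - g j x - (g (j + 1) y - g j y)
          = ((g (j + 1) x - φ x) - (g (j + 1) y - φ y)) - ((g j x - φ x) - (g j y - φ y)) := by
        ring
      rw [e]
      refine (abs_sub _ _).trans ?_
      nlinarith [norm_nonneg (x - y)]
    · have h1 := hb j p hp' z (hz.trans_le (hsle j))
      have h2 := hb (j + 1) p hp' z hz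
      rw [(((hg (j + 1)).differentiable (by norm_num) z).hasFDerivAt.fun_sub
        ((hg j).differentiable (by norm_num) z).hasFDerivAt).fderiv, hδ,
        ← sub_sub_sub_cancel_right _ _ (D p)]
      refine (norm_sub_le _ _).trans ?_
      linarith [hpos j]
  choose ζ hζd hζeq hζb using hex
  have hsum : Summable fun j => 15 * (δ j : ℝ) := by
    simp only [hδ]
    exact ((summable_geometric_of_lt_one (by norm_num) (by norm_num)).mul_left 4).mul_left 15
  have hHas : ∀ x ∈ K, HasSum (fun j => ζ j x) (φ x - g 0 x) := by
    intro x hx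
    have hgs : Summable fun j => g (j + 1) x - g j x := by
      refine Summable.of_norm_bounded (g := fun j => 2 * (1 / 2 : ℝ) ^ j)
        ((summable_geometric_of_lt_one (by norm_num) (by norm_num)).mul_left 2) fun j => ?_
      have h1 := ha j x hx
      have h2 := ha (j + 1) x hx
      rw [pow_succ] at h2
      rw [Real.norm_eq_abs, ← sub_sub_sub_cancel_right _ _ (φ x)]
      refine (abs_sub _ _).trans ?_
      linarith [hpos j]
    have hlim : Tendsto (fun j => g j x) atTop (𝓝 (φ x)) := by
      rw [tendsto_iff_norm_sub_tendsto_zero]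
      exact squeeze_zero (fun _ => norm_nonneg _) (fun j => ha j x hx)
        (tendsto_pow_atTop_nhds_zero_of_lt_one (by norm_num) (by norm_num))
    have h1 : HasSum (fun j => g (j + 1) x - g j x) (φ x - g 0 x) := by
      rw [hgs.hasSum_iff_tendsto_nat]
      simp only [Finset.sum_range_sub (fun j => g j x)]
      exact hlim.sub_const _
    exact h1.congr_fun fun j => hζeq j hx
  have hfd : ∀ x, HasFDerivAt (fun y => ∑' j, ζ j y) (∑' j, fderiv ℝ (ζ j) x) x :=
    hasFDerivAt_tsum hsum (fun j x => ((hζd j).differentiable (by norm_num) x).hasFDerivAt) hζb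
      (hHas x₀ hx₀).summable
  have hCD : ContDiff ℝ 1 fun y => ∑' j, ζ j y := by
    rw [contDiff_one_iff_fderiv]
    refine ⟨fun x => (hfd x).differentiableAt, ?_⟩
    rw [funext fun x => (hfd x).fderiv]
    exact continuous_tsum (fun j => (hζd j).continuous_fderiv (by norm_num)) hsum hζb
  refine ⟨fun x => g 0 x + ∑' j, ζ j x, (hg 0).add hCD, fun x hx => ?_⟩
  simp only [(hHas x hx).tsum_eq]
  ring

end Whitney

end MetricIFT

/-! ### Egorov's theorem for differentiability. -/

namespace MetricIFT

section Egorov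

variable {E F : Type*} [NormedAddCommGroup E] [NormedSpace ℝ E] [FiniteDimensional ℝ E]
  [MeasurableSpace E] [BorelSpace E] [NormedAddCommGroup F] [NormedSpace ℝ F]
  [FiniteDimensional ℝ F]

/-- The inequality is closed in `h`, so a countable dense set of increments suffices. -/
lemma measurableSet_forall_norm_sub_fderiv_le {Φ : E → F} (hΦ : Continuous Φ) (ε δ : ℝ) :
    MeasurableSet {x | ∀ h, ‖h‖ < δ → ‖Φ (x + h) - Φ x - fderiv ℝ Φ x h‖ ≤ ε * ‖h‖} := by
  borelize F
  have : CompleteSpace F := FiniteDimensional.complete ℝ F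
  have : SecondCountableTopology F := inferInstance
  obtain ⟨S, hS, hSd⟩ := TopologicalSpace.exists_countable_dense E
  have e : {x | ∀ h, ‖h‖ < δ → ‖Φ (x + h) - Φ x - fderiv ℝ Φ x h‖ ≤ ε * ‖h‖}
      = ⋂ h ∈ S ∩ Metric.ball 0 δ, {x | ‖Φ (x + h) - Φ x - fderiv ℝ Φ x h‖ ≤ ε * ‖h‖} := by
    ext x
    simp only [mem_ofPred_eq, mem_iInter, mem_inter_iff, mem_ball_zero_iff, and_imp]
    refine ⟨fun H h _ => H h, fun H h hh => ?_⟩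
    have hcl : IsClosed {h | ‖Φ (x + h) - Φ x - fderiv ℝ Φ x h‖ ≤ ε * ‖h‖} :=
      isClosed_le (by fun_prop) (by fun_prop)
    have hmem : h ∈ closure (Metric.ball 0 δ ∩ S) :=
      hSd.open_subset_closure_inter Metric.isOpen_ball (by simpa using hh)
    exact closure_minimal (fun u hu => H u hu.2 (by simpa using hu.1)) hcl hmem
  rw [e]
  refine MeasurableSet.biInter (hS.mono inter_subset_left) fun h _ => ?_
  refine measurableSet_le (Measurable.norm (Measurable.sub (Measurable.sub ?_ hΦ.measurable)
    (measurable_fderiv_apply_const ℝ Φ h))) measurable_const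
  exact (by fun_prop : Continuous fun x => Φ (x + h)).measurable

/-- Differentiability at the points of a set of positive measure is uniform on a subset of
positive measure. -/
theorem exists_uniformlyDifferentiableOn_subset {μ : Measure E} [IsLocallyFiniteMeasure μ]
    {Φ : E → F} (hΦ : Continuous Φ) {B : Set E} (hB : MeasurableSet B) (hBpos : 0 < μ B)
    (hd : ∀ x ∈ B, DifferentiableAt ℝ Φ x) :
    ∃ K ⊆ B, MeasurableSet K ∧ 0 < μ K ∧ UniformlyDifferentiableOn Φ (fderiv ℝ Φ) K := by
  obtain ⟨B', hB'B, hB', hB'pos, hB'fin⟩ : ∃ B' ⊆ B, MeasurableSet B' ∧ 0 < μ B' ∧ μ B' < ∞ := by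
    obtain ⟨B', h1, h2, h3, h4⟩ := Measure.exists_subset_measure_lt_top hB hBpos
    exact ⟨B', h2, h1, h3, h4⟩
  let S : ℕ → ℕ → Set E := fun k j =>
    {x | ∀ h, ‖h‖ < 1 / ((j : ℝ) + 1) →
      ‖Φ (x + h) - Φ x - fderiv ℝ Φ x h‖ ≤ 1 / ((k : ℝ) + 1) * ‖h‖}
  have hS : ∀ k j, MeasurableSet (S k j) := fun k j =>
    measurableSet_forall_norm_sub_fderiv_le hΦ _ _
  have hlim : ∀ k, Tendsto (fun j => μ (B' \ S k j)) atTop (𝓝 0) := by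
    intro k
    have hanti : Antitone fun j => B' \ S k j := by
      intro i j hij
      refine sdiff_subset_sdiff_right fun x hx h hh => hx h (hh.trans_le ?_)
      exact Nat.one_div_le_one_div hij
    have hempty : ⋂ j, B' \ S k j = ∅ := by
      refine eq_empty_of_forall_notMem fun x hx => ?_
      rw [mem_iInter] at hx
      have hdx := (hd x (hB'B (hx 0).1)).hasFDerivAt
      rw [hasFDerivAt_iff_isLittleO_nhds_zero] at hdx
      have h1 := hdx.def (c := 1 / ((k : ℝ) + 1)) (by positivity)
      obtain ⟨r, hr, hball⟩ := Metric.eventually_nhds_iff_ball.1 h1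
      obtain ⟨j, hj⟩ := exists_nat_one_div_lt hr
      exact (hx j).2 fun h hh => hball h (by simpa using hh.trans hj)
    have := tendsto_measure_iInter_atTop (μ := μ) (s := fun j => B' \ S k j)
      (fun j => (hB'.diff (hS k j)).nullMeasurableSet) hanti
      ⟨0, ((measure_mono sdiff_subset).trans_lt hB'fin).ne⟩
    rwa [hempty, measure_empty] at this
  -- For each tolerance `1 / (k + 1)` a scale is chosen whose exceptional set has measure below `ε
  -- k`; the total removed is less than `μ B'`.
  obtain ⟨ε, hε0, hεs⟩ := ENNReal.exists_pos_sum_of_countable' hB'pos.ne' ℕ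
  choose j hj using fun k => ((hlim k).eventually (gt_mem_nhds (hε0 k))).exists
  refine ⟨B' ∩ ⋂ k, S k (j k), inter_subset_left.trans hB'B,
    hB'.inter (MeasurableSet.iInter fun k => hS k _), ?_, ?_⟩
  · by_contra h0
    have h0 : μ (B' ∩ ⋂ k, S k (j k)) = 0 := by simpa using h0
    have hsub : B' ⊆ (B' ∩ ⋂ k, S k (j k)) ∪ ⋃ k, B' \ S k (j k) := by
      intro x hx
      by_cases hxS : x ∈ ⋂ k, S k (j k)
      · exact Or.inl ⟨hx, hxS⟩
      · rw [mem_iInter, not_forall] at hxS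
        obtain ⟨k, hk⟩ := hxS
        exact Or.inr (mem_iUnion.2 ⟨k, hx, hk⟩)
    have : μ B' < μ B' := calc
      μ B' ≤ μ (B' ∩ ⋂ k, S k (j k)) + μ (⋃ k, B' \ S k (j k)) :=
          (measure_mono hsub).trans (measure_union_le _ _)
      _ ≤ 0 + ∑' k, μ (B' \ S k (j k)) := by rw [h0]; gcongr; exact measure_iUnion_le _
      _ ≤ ∑' k, ε k := by rw [zero_add]; exact ENNReal.tsum_le_tsum fun k => (hj k).le
      _ < μ B' := hεs
    exact this.false
  · intro e he
    obtain ⟨k, hk⟩ := exists_nat_one_div_lt he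
    refine ⟨1 / ((j k : ℝ) + 1), by positivity, fun x hx y hy => ?_⟩
    have h1 := mem_iInter.1 hx.2 k (y - x) hy
    rw [add_sub_cancel] at h1
    exact h1.trans (mul_le_mul_of_nonneg_right hk.le (norm_nonneg _))

end Egorov

end MetricIFT

/-! ### Suprema of directional derivatives. -/

namespace MetricIFT

section DerivSup

variable {E : Type*} [NormedAddCommGroup E] [NormedSpace ℝ E] {φ : ℕ → E → ℝ} {L : ℝ≥0}

/-- The supremum of the directional derivatives of a sequence of functions. -/
noncomputable def derivSup (φ : ℕ → E → ℝ) (v p : E) : ℝ := ⨆ i, |fderiv ℝ (φ i) p v|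

lemma abs_fderiv_apply_le (hφ : ∀ i, LipschitzWith L (φ i)) (i : ℕ) (v p : E) :
    |fderiv ℝ (φ i) p v| ≤ L * ‖v‖ :=
  (fderiv ℝ (φ i) p).le_of_opNorm_le (norm_fderiv_le_of_lipschitz ℝ (hφ i)) v

lemma abs_fderiv_le_derivSup (hφ : ∀ i, LipschitzWith L (φ i)) (i : ℕ) (v p : E) :
    |fderiv ℝ (φ i) p v| ≤ derivSup φ v p :=
  le_ciSup (f := fun i => |fderiv ℝ (φ i) p v|)
    ⟨L * ‖v‖, by rintro _ ⟨j, rfl⟩; exact abs_fderiv_apply_le hφ j v p⟩ i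

lemma derivSup_nonneg (v p : E) : 0 ≤ derivSup φ v p := Real.iSup_nonneg fun _ => abs_nonneg _

lemma derivSup_le (hφ : ∀ i, LipschitzWith L (φ i)) (v p : E) : derivSup φ v p ≤ L * ‖v‖ :=
  ciSup_le fun i => abs_fderiv_apply_le hφ i v p

/-- Continuity in the direction, uniform in the point: Lebesgue points are then needed only for
countably many directions. -/
lemma derivSup_le_add (hφ : ∀ i, LipschitzWith L (φ i)) (v w p : E) :
    derivSup φ v p ≤ derivSup φ w p + L * ‖v - w‖ := by
  refine ciSup_le fun i => ?_
  have h1 := abs_fderiv_le_derivSup hφ i w p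
  have h2 := abs_fderiv_apply_le hφ i (v - w) p
  have h3 := abs_add_le (fderiv ℝ (φ i) p w) (fderiv ℝ (φ i) p (v - w))
  rw [← map_add, add_sub_cancel] at h3
  linarith

lemma measurable_derivSup [MeasurableSpace E] [BorelSpace E] (φ : ℕ → E → ℝ) (v : E) :
    Measurable (derivSup φ v) :=
  Measurable.iSup fun i => (measurable_fderiv_apply_const ℝ (φ i) v).abs

end DerivSup

/-! ### From small averages to uniform smallness in all `φ i`. -/

section UniformSmallness

variable {E : Type*} [NormedAddCommGroup E] [InnerProductSpace ℝ E] [FiniteDimensional ℝ E]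
  [MeasurableSpace E] [BorelSpace E]

lemma fderiv_mollify_apply {g : E → ℝ} {L : ℝ≥0} (hg : LipschitzWith L g) {s : ℝ} (hs : s ≠ 0)
    (z v : E) :
    fderiv ℝ (mollify s g) z v = ∫ t, mollifier E t * fderiv ℝ g (z - s • t) v := by
  have h1 := hasDerivAt_mollify_line hg hs z v
  have h2 : HasDerivAt (fun a : ℝ => z + a • v) v 0 := by
    simpa using ((hasDerivAt_id (0 : ℝ)).smul_const v).const_add z
  have h3 : HasFDerivAt (mollify s g) (fderiv ℝ (mollify s g) z) (z + (0 : ℝ) • v) := by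
    simpa using
      ((contDiff_mollify hg.continuous hs).differentiable (by norm_num) z).hasFDerivAt
  have h4 := h3.comp_hasDerivAt (0 : ℝ) h2
  exact h4.unique h1

variable {φ : ℕ → E → ℝ} {L : ℝ≥0}

lemma integrableOn_derivSup (hφ : ∀ i, LipschitzWith L (φ i)) (v : E) {s : Set E}
    (hs : volume s ≠ ∞) : IntegrableOn (derivSup φ v) s := by
  refine Measure.integrableOn_of_bounded (M := L * ‖v‖) hs
    (measurable_derivSup φ v).aestronglyMeasurable (Eventually.of_forall fun p => ?_)
  rw [Real.norm_eq_abs, abs_of_nonneg (derivSup_nonneg v p)]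
  exact derivSup_le hφ v p

lemma locallyIntegrable_derivSup (hφ : ∀ i, LipschitzWith L (φ i)) (v : E) :
    LocallyIntegrable (derivSup φ v) := fun x =>
  ⟨Metric.ball x 1, Metric.ball_mem_nhds x one_pos,
    integrableOn_derivSup hφ v measure_ball_lt_top.ne⟩

/-- At almost every point, `derivSup φ v` has vanishing averages for every `v` in the common kernel
of the derivatives. -/
lemma ae_eventually_integral_derivSup_le (hφ : ∀ i, LipschitzWith L (φ i)) :
    ∀ᵐ x : E, ∀ v, (∀ i, fderiv ℝ (φ i) x v = 0) → ∀ ε > 0, ∀ᶠ r in 𝓝[>] (0 : ℝ),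
      ∫ p in Metric.closedBall x r, derivSup φ v p
        ≤ ε * volume.real (Metric.closedBall x r) := by
  obtain ⟨S, hS, hSd⟩ := TopologicalSpace.exists_countable_dense E
  have h := (ae_ball_iff hS).2 fun w _ => IsUnifLocDoublingMeasure.ae_tendsto_average
    (μ := (volume : Measure E)) (locallyIntegrable_derivSup hφ w) 1
  filter_upwards [h] with x hx v hv ε hε
  -- This makes `L * ‖v - w‖ < ε / 3`: replacing `v` by `w` costs that much at `x` and again in the
  -- average.
  obtain ⟨w, hw, hvw⟩ := Metric.mem_closure_iff.1 (hSd v) (ε / (3 * (L + 1))) (by positivity)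
  rw [dist_eq_norm, lt_div_iff₀ (by positivity)] at hvw
  have hlim := hx w hw (fun _ : ℝ => x) (fun r => r) tendsto_id
    (by filter_upwards [self_mem_nhdsWithin] with r (hr : 0 < r)
        simpa using hr.le)
  have hv0 : derivSup φ v x = 0 := by simp [derivSup, hv]
  have hwx : derivSup φ w x < ε / 2 := by
    have := derivSup_le_add hφ w v x
    rw [hv0, norm_sub_rev] at this
    nlinarith [norm_nonneg (v - w)]
  filter_upwards [hlim.eventually (gt_mem_nhds hwx), self_mem_nhdsWithin] with r hr (hr0 : 0 < r)
  have hV : 0 < volume.real (Metric.closedBall x r) :=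
    ENNReal.toReal_pos (Metric.measure_closedBall_pos _ _ hr0).ne' measure_closedBall_lt_top.ne
  rw [setAverage_eq, smul_eq_mul, inv_mul_lt_iff₀ hV] at hr
  have hfin : volume (Metric.closedBall x r) ≠ ∞ := measure_closedBall_lt_top.ne
  calc ∫ p in Metric.closedBall x r, derivSup φ v p
      ≤ ∫ p in Metric.closedBall x r, (derivSup φ w p + L * ‖v - w‖) :=
        setIntegral_mono (integrableOn_derivSup hφ v hfin)
          ((integrableOn_derivSup hφ w hfin).add (integrableOn_const hfin))
          fun p => derivSup_le_add hφ v w p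
    _ = (∫ p in Metric.closedBall x r, derivSup φ w p)
        + volume.real (Metric.closedBall x r) * (L * ‖v - w‖) := by
        rw [integral_add (integrableOn_derivSup hφ w hfin) (integrableOn_const hfin)]
        simp
    _ ≤ ε * volume.real (Metric.closedBall x r) := by
        nlinarith [norm_nonneg (v - w), L.2]

/-- At a point as in `ae_eventually_integral_derivSup_le`, all the functions `φ i` are
simultaneously almost constant at small scales in the directions of `V`. -/
lemma eventually_forall_abs_sub_le (hφ : ∀ i, LipschitzWith L (φ i)) {x : E} (V : Submodule ℝ E)
    (hV : ∀ v ∈ V, ∀ ε > 0, ∀ᶠ r in 𝓝[>] (0 : ℝ),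
      ∫ p in Metric.closedBall x r, derivSup φ v p ≤ ε * volume.real (Metric.closedBall x r))
    {ε : ℝ} (hε : 0 < ε) :
    ∀ᶠ r in 𝓝[>] (0 : ℝ), ∀ i y z, ‖y - x‖ ≤ 5 * r → ‖z - x‖ ≤ 5 * r → y - z ∈ V →
      |φ i y - φ i z| ≤ ε * r := by
  let b := stdOrthonormalBasis ℝ V
  -- One function, independent of `i`, dominating every derivative in every direction of `V`; this
  -- is the source of uniformity.
  let h : E → ℝ := fun p => ∑ j, derivSup φ (b j : E) p
  have hh0 : ∀ p, 0 ≤ h p := fun p => Finset.sum_nonneg fun j _ => derivSup_nonneg _ _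
  have hle : ∀ i, ∀ v ∈ V, ∀ p, |fderiv ℝ (φ i) p v| ≤ ‖v‖ * h p := by
    intro i v hv p
    have e : v = ∑ j, inner ℝ (b j : E) v • (b j : E) := by
      have := congrArg (Subtype.val) (b.sum_repr' ⟨v, hv⟩)
      simpa using this.symm
    have e2 : fderiv ℝ (φ i) p v
        = ∑ j, inner ℝ (b j : E) v * fderiv ℝ (φ i) p (b j : E) := by
      conv_lhs => rw [e]
      simp [map_sum]
    rw [e2, Finset.mul_sum]
    refine (Finset.abs_sum_le_sum_abs _ _).trans (Finset.sum_le_sum fun j _ => ?_)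
    rw [abs_mul]
    have hb1 : ‖(b j : E)‖ = 1 := b.norm_eq_one j
    refine mul_le_mul ?_ (abs_fderiv_le_derivSup hφ i _ p) (abs_nonneg _) (norm_nonneg _)
    simpa [hb1] using abs_real_inner_le_norm (b j : E) v
  obtain ⟨C, hC⟩ := (continuous_mollifier (E := E)).bounded_above_of_compact_support
    hasCompactSupport_mollifier
  have hC0 : 0 ≤ C := (norm_nonneg _).trans (hC 0)
  set N := Module.finrank ℝ E
  set B := volume.real (Metric.closedBall (0 : E) 1)
  have hB0 : 0 ≤ B := measureReal_nonneg
  -- At the mollification scale `e' * r`, replacing `φ i` by its mollification costs at most `ε r /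
  -- 4` at each endpoint, leaving `ε r / 2` for the gradient estimate.
  set e' := min 1 (ε / (4 * (L + 1))) with he'
  have he'0 : 0 < e' := lt_min one_pos (by positivity)
  have he'1 : e' ≤ 1 := min_le_left _ _
  have he'L : L * e' ≤ ε / 4 := by
    have : e' ≤ ε / (4 * (L + 1)) := min_le_right _ _
    rw [le_div_iff₀ (by positivity)] at this
    nlinarith
  -- Collects the factors relating an average over the ball of radius `6 r` to a gradient of the
  -- mollification: `‖y - z‖ ≤ 10 r`, the kernel bound `C s^{-N}`, and the ball's volume.
  set Q := 10 * (C * (e' ^ N)⁻¹ * 6 ^ N * B) + 1 with hQ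
  have hQ0 : 0 < Q := by positivity
  have hh : ∀ᶠ r in 𝓝[>] (0 : ℝ), ∫ p in Metric.closedBall x r, h p
      ≤ ε / (2 * Q) * volume.real (Metric.closedBall x r) := by
    have h1 : ∀ᶠ r in 𝓝[>] (0 : ℝ), ∀ j, ∫ p in Metric.closedBall x r, derivSup φ (b j : E) p
        ≤ ε / (2 * Q) / (Module.finrank ℝ V + 1) * volume.real (Metric.closedBall x r) :=
      eventually_all.2 fun j => hV _ (b j).2 _ (by positivity)
    filter_upwards [h1] with r hr
    have hfin : volume (Metric.closedBall x r) ≠ ∞ := measure_closedBall_lt_top.ne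
    rw [integral_finsetSum _ fun j _ => integrableOn_derivSup hφ _ hfin]
    refine (Finset.sum_le_sum fun j _ => hr j).trans ?_
    rw [Finset.sum_const, Finset.card_univ, Fintype.card_fin, nsmul_eq_mul, ← mul_assoc]
    refine mul_le_mul_of_nonneg_right ?_ measureReal_nonneg
    rw [mul_div_assoc', div_le_iff₀ (by positivity)]
    nlinarith [show 0 < ε / (2 * Q) by positivity]
  have h6 : Tendsto (fun r : ℝ => 6 * r) (𝓝[>] 0) (𝓝[>] 0) := by
    refine tendsto_nhdsWithin_iff.2 ⟨?_, ?_⟩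
    · have : Tendsto (fun r : ℝ => 6 * r) (𝓝 0) (𝓝 (6 * 0)) :=
        tendsto_id.const_mul 6
      rw [mul_zero] at this
      exact this.mono_left nhdsWithin_le_nhds
    · filter_upwards [self_mem_nhdsWithin] with r (hr : 0 < r)
      exact mul_pos (by norm_num) hr
  filter_upwards [h6.eventually hh, self_mem_nhdsWithin] with r hr (hr0 : 0 < r) i y z hy hz hyz
  set s := e' * r with hs
  have hs0 : 0 < s := mul_pos he'0 hr0
  have hsr : s ≤ r := mul_le_of_le_one_left hr0.le he'1
  have hvol : volume.real (Metric.closedBall x (6 * r)) = (6 * r) ^ N * B := by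
    rw [measureReal_def, Measure.addHaar_closedBall_center, Measure.addHaar_closedBall' _ _
      (by positivity), ENNReal.toReal_mul, ENNReal.toReal_ofReal (by positivity)]
    rfl
  set H := (Metric.closedBall x (6 * r)).indicator h with hH
  have hHint : Integrable H := by
    refine IntegrableOn.integrable_indicator ?_ measurableSet_closedBall
    exact integrable_finsetSum _ fun j _ =>
      integrableOn_derivSup hφ _ measure_closedBall_lt_top.ne
  have hder : ∀ q, ‖q - x‖ ≤ 5 * r →
      |fderiv ℝ (mollify s (φ i)) q (y - z)| ≤ ε / 2 * r := by
    intro q hq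
    rw [fderiv_mollify_apply (hφ i) hs0.ne', ← Real.norm_eq_abs]
    have hcomp : Integrable fun t => H (q - s • t) :=
      ((hHint.comp_sub_left q).comp_smul hs0.ne')
    have hI : ∫ t, H (q - s • t) = (s ^ N)⁻¹ * ∫ p in Metric.closedBall x (6 * r), h p := by
      rw [Measure.integral_comp_smul volume (fun t => H (q - t)) s,
        integral_sub_left_eq_self (fun t => H t) volume q, hH,
        integral_indicator measurableSet_closedBall, smul_eq_mul,
        abs_of_pos (inv_pos.2 (pow_pos hs0 _))]
    have h1 : ‖∫ t, mollifier E t * fderiv ℝ (φ i) (q - s • t) (y - z)‖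
        ≤ ∫ t, (C * ‖y - z‖) * H (q - s • t) := by
      refine norm_integral_le_of_norm_le (hcomp.const_mul _) (Eventually.of_forall fun t => ?_)
      rcases lt_or_ge ‖t‖ 1 with ht | ht
      · have hmem : q - s • t ∈ Metric.closedBall x (6 * r) := by
          rw [mem_closedBall_iff_norm, sub_right_comm]
          refine (norm_sub_le _ _).trans ?_
          have := norm_smul_lt_of_norm_lt_one hs0 ht
          linarith
        rw [hH, indicator_of_mem hmem, norm_mul, mul_assoc]
        exact mul_le_mul (hC t) (hle i _ hyz _) (norm_nonneg _) hC0
      · rw [mollifier_eq_zero ht, zero_mul, norm_zero]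
        exact mul_nonneg (mul_nonneg hC0 (norm_nonneg _)) (indicator_nonneg (fun p _ => hh0 p) _)
    have hyz10 : ‖y - z‖ ≤ 10 * r := by
      rw [← sub_sub_sub_cancel_right y z x]
      refine (norm_sub_le _ _).trans ?_
      linarith
    refine h1.trans ?_
    rw [integral_const_mul, hI]
    rw [hvol] at hr
    calc C * ‖y - z‖ * ((s ^ N)⁻¹ * ∫ p in Metric.closedBall x (6 * r), h p)
        ≤ C * (10 * r) * ((s ^ N)⁻¹ * (ε / (2 * Q) * ((6 * r) ^ N * B))) := by
          have : 0 ≤ ∫ p in Metric.closedBall x (6 * r), h p := integral_nonneg hh0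
          gcongr
      _ = (10 * (C * (e' ^ N)⁻¹ * 6 ^ N * B)) / Q * (ε / 2 * r) := by
          rw [hs, mul_pow, mul_pow]
          field_simp
      _ ≤ 1 * (ε / 2 * r) := by
          refine mul_le_mul_of_nonneg_right ?_ (by positivity)
          rw [div_le_one hQ0, hQ]
          linarith
      _ = _ := one_mul _
  have hmvt : |mollify s (φ i) y - mollify s (φ i) z| ≤ ε / 2 * r := by
    have hseg : ∀ a ∈ Icc (0 : ℝ) 1, ‖z + a • (y - z) - x‖ ≤ 5 * r := by
      intro a ha
      have hconv := convex_closedBall x (5 * r)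
      have := hconv.add_smul_sub_mem (x := z) (y := y) (mem_closedBall_iff_norm.2 hz)
        (mem_closedBall_iff_norm.2 hy) ha
      exact mem_closedBall_iff_norm.1 this
    have h1 : ∀ a ∈ Icc (0 : ℝ) 1, HasDerivWithinAt (fun a : ℝ => mollify s (φ i) (z + a • (y - z)))
        (fderiv ℝ (mollify s (φ i)) (z + a • (y - z)) (y - z)) (Icc 0 1) a := by
      intro a _
      have h2 : HasDerivAt (fun a : ℝ => z + a • (y - z)) (y - z) a := by
        simpa using ((hasDerivAt_id a).smul_const (y - z)).const_add z
      exact (((contDiff_mollify (hφ i).continuous hs0.ne').differentiable (by norm_num)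
        _).hasFDerivAt.comp_hasDerivAt a h2).hasDerivWithinAt
    have h3 := (convex_Icc (0 : ℝ) 1).norm_image_sub_le_of_norm_hasDerivWithin_le h1
      (fun a ha => (Real.norm_eq_abs _).trans_le (hder _ (hseg a ha)))
      (left_mem_Icc.2 zero_le_one) (right_mem_Icc.2 zero_le_one)
    simpa using h3
  have hy1 := abs_mollify_sub_self_le (hφ i) hs0 y
  have hz1 := abs_mollify_sub_self_le (hφ i) hs0 z
  have hLs : L * s ≤ ε / 4 * r := by
    rw [hs, ← mul_assoc]
    exact mul_le_mul_of_nonneg_right he'L hr0.le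
  rw [abs_le] at *
  constructor <;> linarith

end UniformSmallness

end MetricIFT

/-! ### Vanishing density when the derivatives have rank below `n`. -/

namespace MetricIFT

section Density

lemma unitBallVolume_pos (n : ℕ) : 0 < unitBallVolume n := Metric.measure_ball_pos _ _ one_pos

lemma hausdorffContent_le_of_cover {X : Type*} [MetricSpace X] {n : ℕ} {ι : Type*} [Fintype ι]
    {S : Set X} (t : ι → Set X) (hS : S ⊆ ⋃ i, t i) {d : ℝ≥0∞} (hd : ∀ i, Metric.ediam (t i) ≤ d) :
    hausdorffContent n S ≤ unitBallVolume n / 2 ^ n * (Fintype.card ι * d ^ n) := by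
  classical
  let e := Fintype.equivFin ι
  -- Padding by empty sets costs nothing, even for `n = 0`.
  let t' : ℕ → Set X := fun j => if h : j < Fintype.card ι then t (e.symm ⟨j, h⟩) else ∅
  have hcov : S ⊆ ⋃ j, t' j := by
    refine hS.trans (iUnion_subset fun i => ?_)
    refine subset_iUnion_of_subset (e i : ℕ) ?_
    simp [t']
  refine mul_le_mul_right ((iInf₂_le t' hcov).trans ?_) _
  rw [tsum_eq_sum (s := Finset.range (Fintype.card ι))]
  · refine (Finset.sum_le_card_nsmul _ _ (d ^ n) fun j hj => ?_).trans ?_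
    · refine iSup_le fun _ => ?_
      have hj' : j < Fintype.card ι := Finset.mem_range.1 hj
      simp only [t', hj', dite_true]
      gcongr
      exact hd _
    · simp
  · intro j hj
    have hj' : ¬ j < Fintype.card ι := fun h => hj (Finset.mem_range.2 h)
    simp [t', hj']

/-- If all the distances between image points are controlled by the functions `φ i`, and these are
almost constant at small scales in directions orthogonal to a subspace of dimension less than `n`,
then the upper `n`-density vanishes. -/
lemma upperDensity_eq_zero {X : Type*} [MetricSpace X] {k n : ℕ}
    {A : Set (EuclideanSpace ℝ (Fin k))} {f : EuclideanSpace ℝ (Fin k) → X}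
    {φ : ℕ → EuclideanSpace ℝ (Fin k) → ℝ} {L : ℝ≥0} (hφ : ∀ i, LipschitzWith L (φ i))
    (hdist : ∀ y ∈ A, ∀ z ∈ A, ∀ c, (∀ i, |φ i y - φ i z| ≤ c) → dist (f y) (f z) ≤ c)
    {x : EuclideanSpace ℝ (Fin k)} (W : Submodule ℝ (EuclideanSpace ℝ (Fin k)))
    (hW : Module.finrank ℝ W < n)
    (hsmall : ∀ ε > 0, ∀ᶠ r in 𝓝[>] (0 : ℝ), ∀ i y z, ‖y - x‖ ≤ 5 * r → ‖z - x‖ ≤ 5 * r →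
      y - z ∈ Wᗮ → |φ i y - φ i z| ≤ ε * r) :
    upperDensity n A f x = 0 := by
  set d := Module.finrank ℝ W with hd
  let b := stdOrthonormalBasis ℝ W
  -- A cell image has diameter at most `c r / M`: `1` comes from the motion along `Wᗮ`, `L * d` from
  -- the motion along `W`.
  set c : ℝ := 1 + L * d with hc
  have hc0 : 0 < c := by positivity
  have key : ∀ M : ℕ, upperDensity n A f x ≤ ENNReal.ofReal (3 ^ d * c ^ n / ((M : ℝ) + 1)) := by
    intro M'
    set M := M' + 1 with hM
    have hM0 : (0 : ℝ) < M := by positivity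
    rw [show (M' : ℝ) + 1 = M by rw [hM]; push_cast; ring]
    refine limsup_le_of_le (by isBoundedDefault) ?_
    filter_upwards [hsmall (1 / M) (by positivity), self_mem_nhdsWithin] with r hr (hr0 : 0 < r)
    let cell : EuclideanSpace ℝ (Fin k) → Fin d → ℤ := fun y j =>
      ⌊inner ℝ (b j : EuclideanSpace ℝ (Fin k)) (y - x) * M / r⌋
    have hcoord : ∀ (j : Fin d) (u : EuclideanSpace ℝ (Fin k)),
        |inner ℝ (b j : EuclideanSpace ℝ (Fin k)) u| ≤ ‖u‖ := by
      intro j u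
      have hb1 : ‖(b j : EuclideanSpace ℝ (Fin k))‖ = 1 := b.norm_eq_one j
      simpa [hb1] using abs_real_inner_le_norm (b j : EuclideanSpace ℝ (Fin k)) u
    let t : (Fin d → Fin (2 * M + 1)) → Set X := fun a =>
      f '' {y ∈ Metric.ball x r ∩ A | ∀ j, cell y j + M = (a j : ℤ)}
    have hcov : f '' (Metric.ball x r ∩ A) ⊆ ⋃ a, t a := by
      rintro _ ⟨y, hy, rfl⟩
      have hyr : ‖y - x‖ < r := by simpa [dist_eq_norm] using hy.1
      have hrange : ∀ j, 0 ≤ cell y j + M ∧ cell y j + M ≤ 2 * M := by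
        intro j
        have h1 := abs_le.1 ((hcoord j (y - x)).trans hyr.le)
        have h2 : -(M : ℝ) ≤ inner ℝ (b j : EuclideanSpace ℝ (Fin k)) (y - x) * M / r := by
          rw [le_div_iff₀ hr0]; nlinarith
        have h3 : inner ℝ (b j : EuclideanSpace ℝ (Fin k)) (y - x) * M / r ≤ M := by
          rw [div_le_iff₀ hr0]; nlinarith
        have h4 : -(M : ℤ) ≤ cell y j := Int.le_floor.2 (by push_cast; exact h2)
        have h5 : cell y j ≤ M := by
          have := (Int.floor_le _).trans h3
          exact_mod_cast this
        constructor <;> linarith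
      refine mem_iUnion.2 ⟨fun j => ⟨(cell y j + M).toNat, ?_⟩, ?_⟩
      · have := hrange j
        omega
      · refine ⟨y, ⟨hy, fun j => ?_⟩, rfl⟩
        simp only
        rw [Int.toNat_of_nonneg (hrange j).1]
    have hdiam : ∀ a, Metric.ediam (t a) ≤ ENNReal.ofReal (c / M * r) := by
      intro a
      refine Metric.ediam_le ?_
      rintro _ ⟨y, ⟨⟨hy, hyA⟩, hya⟩, rfl⟩ _ ⟨z, ⟨⟨hz, hzA⟩, hza⟩, rfl⟩
      rw [edist_dist]
      refine ENNReal.ofReal_le_ofReal (hdist y hyA z hzA _ fun i => ?_)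
      have hyr : ‖y - x‖ < r := by simpa [dist_eq_norm] using hy
      have hzr : ‖z - x‖ < r := by simpa [dist_eq_norm] using hz
      -- Go from `z` to `y` through `z + w`: the first leg lies in `W` and is short, the second lies
      -- in `Wᗮ`.
      set w := W.starProjection (y - z) with hw
      have hwsum : w = ∑ j, inner ℝ (b j : EuclideanSpace ℝ (Fin k)) (y - z) •
          (b j : EuclideanSpace ℝ (Fin k)) := by
        rw [hw, Submodule.starProjection_apply, b.orthogonalProjectionOnto_apply_eq_sum,
          Submodule.coe_sum]
        rfl
      have hwr : ‖w‖ ≤ d * (r / M) := by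
        rw [hwsum]
        refine (norm_sum_le _ _).trans ?_
        have : ∀ j ∈ Finset.univ, ‖inner ℝ (b j : EuclideanSpace ℝ (Fin k)) (y - z) •
            (b j : EuclideanSpace ℝ (Fin k))‖ ≤ r / M := by
          intro j _
          have hb1 : ‖(b j : EuclideanSpace ℝ (Fin k))‖ = 1 := b.norm_eq_one j
          rw [norm_smul, hb1, mul_one, Real.norm_eq_abs]
          have hfl : cell y j = cell z j := by linarith [hya j, hza j]
          have h1 := Int.abs_sub_lt_one_of_floor_eq_floor hfl
          rw [← sub_div, ← sub_mul, ← inner_sub_right, sub_sub_sub_cancel_right, abs_div, abs_mul,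
            abs_of_pos hr0, abs_of_pos hM0, div_lt_one hr0] at h1
          rw [le_div_iff₀ hM0]
          exact h1.le
        refine (Finset.sum_le_card_nsmul _ _ _ this).trans_eq ?_
        rw [Finset.card_univ, Fintype.card_fin, nsmul_eq_mul]
      have hyz : ‖y - z‖ ≤ 2 * r := by
        rw [← sub_sub_sub_cancel_right y z x]
        refine (norm_sub_le _ _).trans ?_
        linarith
      have hwn : ‖w‖ ≤ 2 * r := (W.norm_starProjection_apply_le _).trans hyz
      have hzw : ‖z + w - x‖ ≤ 5 * r := by
        rw [add_sub_right_comm]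
        refine (norm_add_le _ _).trans ?_
        linarith
      have hmem : y - (z + w) ∈ Wᗮ := by
        rw [← sub_sub]
        exact W.sub_starProjection_mem_orthogonal (y - z)
      have h1 := hr i y (z + w) (by linarith) hzw hmem
      have h2 := (hφ i).dist_le_mul (z + w) z
      rw [Real.dist_eq, dist_self_add_left] at h2
      have h3 : L * ‖w‖ ≤ L * (d * (r / M)) := mul_le_mul_of_nonneg_left hwr L.2
      calc |φ i y - φ i z| = |(φ i y - φ i (z + w)) + (φ i (z + w) - φ i z)| := by
            rw [sub_add_sub_cancel]
        _ ≤ |φ i y - φ i (z + w)| + |φ i (z + w) - φ i z| := abs_add_le _ _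
        _ ≤ 1 / M * r + L * (d * (r / M)) := by linarith
        _ = c / M * r := by rw [hc]; field_simp
    refine ENNReal.div_le_of_le_mul ?_
    refine (hausdorffContent_le_of_cover t hcov hdiam).trans ?_
    -- The floors take the `2M + 1` values from `-M` to `M`; since `d < n`, a factor `1 / M` is left
    -- over.
    have hreal : ((2 * M + 1 : ℝ)) ^ d * (c / M * r) ^ n ≤ 3 ^ d * c ^ n / M * r ^ n := by
      have hM1 : (1 : ℝ) ≤ M := by rw [hM]; push_cast; linarith [(Nat.cast_nonneg M' : (0 : ℝ) ≤ M')]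
      have h1 : ((2 * M + 1 : ℝ)) ^ d ≤ (3 * M) ^ d := by gcongr; linarith
      have h2 : (M : ℝ) ^ d * M ≤ M ^ n := by
        rw [← pow_succ]; exact pow_le_pow_right₀ hM1 hW
      rw [mul_pow, div_pow, ← mul_assoc]
      refine mul_le_mul_of_nonneg_right ?_ (by positivity)
      rw [mul_div_assoc', div_le_div_iff₀ (by positivity) hM0]
      calc ((2 * M + 1 : ℝ)) ^ d * c ^ n * M ≤ (3 * M) ^ d * c ^ n * M := by gcongr
        _ = 3 ^ d * c ^ n * (M ^ d * M) := by rw [mul_pow]; ring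
        _ ≤ 3 ^ d * c ^ n * M ^ n := by gcongr
    have hcard : (Fintype.card (Fin d → Fin (2 * M + 1)) : ℝ≥0∞) * ENNReal.ofReal (c / M * r) ^ n
        ≤ ENNReal.ofReal (3 ^ d * c ^ n / M) * ENNReal.ofReal r ^ n := by
      rw [← ENNReal.ofReal_pow (by positivity), ← ENNReal.ofReal_pow hr0.le,
        ← ENNReal.ofReal_mul (by positivity), ← ENNReal.ofReal_natCast,
        ← ENNReal.ofReal_mul (by positivity)]
      refine ENNReal.ofReal_le_ofReal ?_
      simpa using hreal
    calc unitBallVolume n / 2 ^ n * _ ≤ unitBallVolume n *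
          (ENNReal.ofReal (3 ^ d * c ^ n / M) * ENNReal.ofReal r ^ n) := by
          refine mul_le_mul' (ENNReal.div_le_of_le_mul ?_) hcard
          exact le_mul_of_one_le_right' (one_le_pow₀ (by norm_num))
      _ = _ := by ring
  have h1 : Tendsto (fun M : ℕ => 3 ^ d * c ^ n / ((M : ℝ) + 1)) atTop (𝓝 0) :=
    tendsto_const_nhds.div_atTop (tendsto_natCast_atTop_atTop.atTop_add tendsto_const_nhds)
  have h2 := ENNReal.tendsto_ofReal h1
  rw [ENNReal.ofReal_zero] at h2
  exact le_antisymm (ge_of_tendsto' h2 key) bot_le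

/-- At almost every point where the upper `n`-density is positive, some `n` of the derivatives of
the functions `φ i` are linearly independent. -/
theorem ae_exists_linearIndependent_fderiv {X : Type*} [MetricSpace X] {k n : ℕ}
    {A : Set (EuclideanSpace ℝ (Fin k))} {f : EuclideanSpace ℝ (Fin k) → X}
    {φ : ℕ → EuclideanSpace ℝ (Fin k) → ℝ} {L : ℝ≥0} (hφ : ∀ i, LipschitzWith L (φ i))
    (hdist : ∀ y ∈ A, ∀ z ∈ A, ∀ c, (∀ i, |φ i y - φ i z| ≤ c) → dist (f y) (f z) ≤ c) :
    ∀ᵐ x : EuclideanSpace ℝ (Fin k), 0 < upperDensity n A f x →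
      ∃ I : Fin n → ℕ, LinearIndependent ℝ fun j => fderiv ℝ (φ (I j)) x := by
  filter_upwards [ae_eventually_integral_derivSup_le hφ] with x hx hpos
  by_contra hI
  let D := (InnerProductSpace.toDual ℝ (EuclideanSpace ℝ (Fin k))).symm
  let grad : ℕ → EuclideanSpace ℝ (Fin k) := fun i => D (fderiv ℝ (φ i) x)
  let W := Submodule.span ℝ (range grad)
  refine hpos.ne' (upperDensity_eq_zero hφ hdist W ?_ fun ε hε =>
    eventually_forall_abs_sub_le hφ Wᗮ (fun v hv => hx v fun i => ?_) hε)
  -- A spanning family of rank at least `n` contains `n` independent gradients.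
  · by_contra! hle
    obtain ⟨g, hg, -, hgi⟩ := Submodule.exists_fun_fin_finrank_span_eq ℝ (range grad)
    choose J hJ using hg
    refine hI ⟨fun j => J (Fin.castLE hle j), ?_⟩
    have h1 : LinearIndependent ℝ fun j => grad (J (Fin.castLE hle j)) := by
      simp only [hJ]
      exact hgi.comp _ (Fin.castLE_injective hle)
    exact LinearIndependent.of_comp D.toLinearEquiv.toLinearMap h1
  · have h1 : inner ℝ (grad i) v = 0 := hv _ (Submodule.subset_span (mem_range_self i))
    rwa [InnerProductSpace.toDual_symm_apply] at h1

end Density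

end MetricIFT

/-! ### Hausdorff measure and projections. -/

namespace MetricIFT

lemma isBiLipschitzOn_of_dist_le {Y Z : Type*} [MetricSpace Y] [MetricSpace Z] {f : Y → Z}
    {s : Set Y} (a b : ℝ) (ha : ∀ x ∈ s, ∀ y ∈ s, dist (f x) (f y) ≤ a * dist x y)
    (hb : ∀ x ∈ s, ∀ y ∈ s, dist x y ≤ b * dist (f x) (f y)) : IsBiLipschitzOn f s := by
  have h1 : 0 < max (max a b) 1 := lt_max_of_lt_right one_pos
  refine ⟨max (max a b) 1, h1, fun x hx y hy => ⟨?_, ?_⟩⟩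
  · rw [inv_mul_le_iff₀ h1]
    exact (hb x hx y hy).trans (mul_le_mul_of_nonneg_right
      ((le_max_right _ _).trans (le_max_left _ _)) dist_nonneg)
  · exact (ha x hx y hy).trans (mul_le_mul_of_nonneg_right
      ((le_max_left _ _).trans (le_max_left _ _)) dist_nonneg)

section HausdorffMeasure

/-- Passing to the sup norm is 1-Lipschitz, and on `Fin n → ℝ` the unnormalized Hausdorff measure is
Lebesgue measure. -/
lemma hausdorffMeasure_pos_of_volume_image_pos {X : Type*} [MetricSpace X] [MeasurableSpace X]
    [BorelSpace X] {n : ℕ} {C : ℝ≥0} {p : X → EuclideanSpace ℝ (Fin n)} (hp : LipschitzWith C p)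
    {S : Set X} (h : 0 < volume (p '' S)) : 0 < Measure.hausdorffMeasure (n : ℝ) S := by
  by_contra h0
  have h0 : Measure.hausdorffMeasure (n : ℝ) S = 0 := by simpa using h0
  have hq : LipschitzWith (1 * C) ((WithLp.ofLp : EuclideanSpace ℝ (Fin n) → Fin n → ℝ) ∘ p) :=
    (PiLp.lipschitzWith_ofLp 2 _).comp hp
  have h1 := hq.hausdorffMeasure_image_le (Nat.cast_nonneg n) S
  have h2 : (Measure.hausdorffMeasure (n : ℝ) : Measure (Fin n → ℝ)) = volume := by
    simpa using hausdorffMeasure_pi_real (ι := Fin n)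
  rw [h0, mul_zero, h2, nonpos_iff_eq_zero, image_comp] at h1
  have h3 := (EuclideanSpace.volume_preserving_symm_measurableEquiv_toLp
    (Fin n)).measure_preimage_equiv (WithLp.ofLp '' (p '' S))
  rw [h1] at h3
  refine h.ne' (measure_mono_null (fun z hz => ?_) h3)
  exact ⟨z, hz, rfl⟩

/-- `projFirst` as a linear map. -/
noncomputable def projFirstLinear (n m : ℕ) :
    EuclideanSpace ℝ (Fin (n + m)) →ₗ[ℝ] EuclideanSpace ℝ (Fin n) where
  toFun := projFirst
  map_add' _ _ := rfl
  map_smul' _ _ := rfl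

lemma projFirstLinear_surjective (n m : ℕ) : Function.Surjective (projFirstLinear n m) := by
  intro x
  refine ⟨WithLp.toLp 2 (Fin.append x.ofLp 0), ?_⟩
  ext i
  exact Fin.append_left x.ofLp (0 : Fin m → ℝ) i

lemma volume_image_projFirst_pos {n m : ℕ} {S : Set (EuclideanSpace ℝ (Fin (n + m)))}
    (h : 0 < volume S) : 0 < volume (projFirst '' S) := by
  by_contra h0
  have h0 : volume (projFirst '' S) = 0 := by simpa using h0
  obtain ⟨T, hST, hT, hT0⟩ := exists_measurable_superset_of_null h0
  have h1 := (ae_comp_linearMap_mem_iff (projFirstLinear n m) volume volume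
    (projFirstLinear_surjective n m) hT.compl).2 (measure_eq_zero_iff_ae_notMem.1 hT0)
  have h2 : ∀ᵐ z : EuclideanSpace ℝ (Fin (n + m)), z ∉ S := by
    filter_upwards [h1] with z hz hzS
    exact hz (hST (mem_image_of_mem _ hzS))
  exact h.ne' (measure_eq_zero_iff_ae_notMem.2 h2)

lemma dist_eq_dist_projFirst {n m : ℕ} {z w : EuclideanSpace ℝ (Fin (n + m))}
    (h : projLast z = projLast w) : dist z w = dist (projFirst z) (projFirst w) := by
  have h' : ∀ j, z (Fin.natAdd n j) = w (Fin.natAdd n j) := fun j =>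
    congrArg (fun u : EuclideanSpace ℝ (Fin m) => u j) h
  rw [EuclideanSpace.dist_eq, EuclideanSpace.dist_eq, Fin.sum_univ_add]
  simp [h', projFirst]

lemma lipschitzWith_sqrt_toLp {X : Type*} [MetricSpace X] {n : ℕ} {p : Fin n → X → ℝ}
    (hp : ∀ j, LipschitzWith 1 (p j)) :
    LipschitzWith (NNReal.sqrt n) fun x => (WithLp.toLp 2 fun j => p j x :
      EuclideanSpace ℝ (Fin n)) := by
  refine LipschitzWith.of_dist_le_mul fun x y => ?_
  rw [EuclideanSpace.dist_eq, Real.coe_sqrt, NNReal.coe_natCast, Real.sqrt_le_left (by positivity),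
    mul_pow, Real.sq_sqrt (Nat.cast_nonneg n)]
  refine (Finset.sum_le_card_nsmul _ _ (dist x y ^ 2) fun j _ => ?_).trans_eq (by simp)
  have := (hp j).dist_le_mul x y
  rw [NNReal.coe_one, one_mul] at this
  exact pow_le_pow_left₀ dist_nonneg this 2

end HausdorffMeasure

/-! ### Completing `n` functions to a diffeomorphism. -/

section InverseFunction

/-- Two differentiable functions have the same derivative at almost every point of a set on which
they agree. -/
lemma ae_fderiv_eq_of_eqOn {E : Type*} [NormedAddCommGroup E] [NormedSpace ℝ E]
    [FiniteDimensional ℝ E] [MeasurableSpace E] [BorelSpace E] (μ : Measure E)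
    [μ.IsAddHaarMeasure] {φ ψ : E → ℝ} {K : Set E} (hK : MeasurableSet K)
    (hφ : ∀ x ∈ K, DifferentiableAt ℝ φ x) (hψ : ∀ x ∈ K, DifferentiableAt ℝ ψ x)
    (h : EqOn ψ φ K) : ∀ᵐ x ∂μ.restrict K, fderiv ℝ ψ x = fderiv ℝ φ x := by
  rcases subsingleton_or_nontrivial E with hE | hE
  · exact Eventually.of_forall fun x => by ext v; simp [Subsingleton.elim v 0]
  obtain ⟨e, he⟩ := exists_ne (0 : E)
  -- The difference vanishes on `K`, hence is approximated there by the zero map with constant `0`.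
  -- Multiplying by `e` makes it a self-map of `E`.
  have hap : ApproximatesLinearOn (fun x => (ψ x - φ x) • e) (0 : E →L[ℝ] E) K 0 := by
    intro x hx y hy
    simp [h hx, h hy]
  have h1 := hap.norm_fderiv_sub_le μ hK (fun x => (fderiv ℝ ψ x - fderiv ℝ φ x).smulRight e)
    fun x hx => (((hψ x hx).hasFDerivAt.fun_sub (hφ x hx).hasFDerivAt).smul_const
      e).hasFDerivWithinAt
  filter_upwards [h1] with x hx
  have h2 : fderiv ℝ ψ x - fderiv ℝ φ x = 0 ∨ e = 0 := by simpa using hx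
  exact sub_eq_zero.1 (h2.resolve_right he)

/-- `C¹` functions with linearly independent derivatives at a point are the first components of a
local bi-Lipschitz `C¹`-diffeomorphism. -/
theorem exists_isBiLipschitzC1Diffeo {n m : ℕ} {ψ : Fin n → EuclideanSpace ℝ (Fin (n + m)) → ℝ}
    (hψ : ∀ j, ContDiff ℝ 1 (ψ j)) {x₀ : EuclideanSpace ℝ (Fin (n + m))}
    (hli : LinearIndependent ℝ fun j => fderiv ℝ (ψ j) x₀) :
    ∃ G : OpenPartialHomeomorph (EuclideanSpace ℝ (Fin (n + m))) (EuclideanSpace ℝ (Fin (n + m))),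
      x₀ ∈ G.source ∧ IsBiLipschitzC1Diffeo G ∧
      ∀ z j, G z (Fin.castAdd m j) = ψ j z := by
  let D := (InnerProductSpace.toDual ℝ (EuclideanSpace ℝ (Fin (n + m)))).symm
  let grad : Fin n → EuclideanSpace ℝ (Fin (n + m)) := fun j => D (fderiv ℝ (ψ j) x₀)
  have hgrad : LinearIndependent ℝ grad :=
    hli.map' D.toLinearEquiv.toLinearMap D.toLinearEquiv.ker
  let W := Submodule.span ℝ (range grad)
  have hWm : Module.finrank ℝ Wᗮ = m := by
    have h1 := W.finrank_add_finrank_orthogonal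
    have h2 : Module.finrank ℝ W = n := by simpa using finrank_span_eq_card hgrad
    rw [h2, finrank_euclideanSpace_fin] at h1
    omega
  let c := (stdOrthonormalBasis ℝ Wᗮ).reindex (finCongr hWm)
  -- The missing coordinates are linear, along an orthonormal basis of `Wᗮ`: a vector killed by the
  -- first `n` derivatives lies in `Wᗮ`, and the others then force it to be zero.
  let comp : Fin (n + m) → EuclideanSpace ℝ (Fin (n + m)) → ℝ :=
    Fin.addCases ψ fun j x => inner ℝ (c j : EuclideanSpace ℝ (Fin (n + m))) x
  have hcl : ∀ j, comp (Fin.castAdd m j) = ψ j := fun j => Fin.addCases_left j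
  have hcr : ∀ j, comp (Fin.natAdd n j) = fun x =>
      inner ℝ (c j : EuclideanSpace ℝ (Fin (n + m))) x := fun j => Fin.addCases_right j
  let G₀ : EuclideanSpace ℝ (Fin (n + m)) → EuclideanSpace ℝ (Fin (n + m)) :=
    fun x => WithLp.toLp 2 fun i => comp i x
  have hG₀ : ContDiff ℝ 1 G₀ := by
    refine contDiff_euclidean.2 fun i => ?_
    change ContDiff ℝ 1 (comp i)
    refine Fin.addCases (fun j => ?_) (fun j => ?_) i
    · rw [hcl]; exact hψ j
    · rw [hcr]; exact contDiff_const.inner ℝ contDiff_id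
  have hcomp : ∀ i v, (fderiv ℝ G₀ x₀ v) i = fderiv ℝ (comp i) x₀ v := by
    intro i v
    have h1 := (EuclideanSpace.proj i : EuclideanSpace ℝ (Fin (n + m)) →L[ℝ] ℝ).hasFDerivAt.comp x₀
      (hG₀.differentiable (by norm_num) x₀).hasFDerivAt
    have h2 : fderiv ℝ (comp i) x₀ = _ := h1.fderiv
    rw [h2]
    rfl
  have hinj : Function.Injective (fderiv ℝ G₀ x₀) := by
    refine (injective_iff_map_eq_zero _).2 fun v hv => ?_
    have hv' : ∀ i, fderiv ℝ (comp i) x₀ v = 0 := fun i => by rw [← hcomp, hv]; rfl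
    have hvW : v ∈ Wᗮ := by
      refine Submodule.mem_orthogonal _ _ |>.2 fun u hu => ?_
      induction hu using Submodule.span_induction with
      | mem u hu =>
        obtain ⟨j, rfl⟩ := hu
        have := hv' (Fin.castAdd m j)
        rw [hcl] at this
        simpa only [grad, D, InnerProductSpace.toDual_symm_apply] using this
      | zero => simp
      | add u w _ _ hu hw => rw [inner_add_left, hu, hw, add_zero]
      | smul a u _ hu => rw [inner_smul_left, hu, mul_zero]
    have hz : ∀ j, inner ℝ (c j) (⟨v, hvW⟩ : Wᗮ) = 0 := by
      intro j
      have := hv' (Fin.natAdd n j)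
      have h2 : HasFDerivAt (fun x => inner ℝ (c j : EuclideanSpace ℝ (Fin (n + m))) x)
          (innerSL ℝ (c j : EuclideanSpace ℝ (Fin (n + m)))) x₀ :=
        (innerSL ℝ (c j : EuclideanSpace ℝ (Fin (n + m)))).hasFDerivAt
      rw [hcr, h2.fderiv] at this
      exact this
    have h3 : (⟨v, hvW⟩ : Wᗮ) = 0 := by
      rw [← c.sum_repr' ⟨v, hvW⟩]
      exact Finset.sum_eq_zero fun j _ => by rw [hz, zero_smul]
    exact congrArg Subtype.val h3
  let e : EuclideanSpace ℝ (Fin (n + m)) ≃L[ℝ] EuclideanSpace ℝ (Fin (n + m)) :=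
    (LinearEquiv.ofInjectiveEndo (fderiv ℝ G₀ x₀).toLinearMap hinj).toContinuousLinearEquiv
  have he : (e : EuclideanSpace ℝ (Fin (n + m)) →L[ℝ] EuclideanSpace ℝ (Fin (n + m)))
      = fderiv ℝ G₀ x₀ := by ext v; rfl
  have hstrict : HasStrictFDerivAt G₀
      (e : EuclideanSpace ℝ (Fin (n + m)) →L[ℝ] EuclideanSpace ℝ (Fin (n + m))) x₀ := by
    rw [he]
    exact hG₀.contDiffAt.hasStrictFDerivAt (by norm_num)
  obtain ⟨s, hx₀s, hs, happ⟩ := hstrict.approximates_deriv_on_open_nhds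
  -- Restricting to points with invertible derivative makes the inverse `C¹` on the whole target.
  let R : Set (EuclideanSpace ℝ (Fin (n + m))) :=
    fderiv ℝ G₀ ⁻¹' range ContinuousLinearEquiv.toContinuousLinearMap
  have hR : IsOpen R := ContinuousLinearEquiv.isOpen.preimage (hG₀.continuous_fderiv (by norm_num))
  have happ' := happ.mono_set (inter_subset_left : s ∩ R ⊆ s)
  have hc : Subsingleton (EuclideanSpace ℝ (Fin (n + m))) ∨
      ‖(e.symm : EuclideanSpace ℝ (Fin (n + m)) →L[ℝ] EuclideanSpace ℝ (Fin (n + m)))‖₊⁻¹ / 2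
        < ‖(e.symm : EuclideanSpace ℝ (Fin (n + m)) →L[ℝ] EuclideanSpace ℝ (Fin (n + m)))‖₊⁻¹ := by
    rcases e.subsingleton_or_nnnorm_symm_pos with h | h
    · exact Or.inl h
    · exact Or.inr (NNReal.half_lt_self (inv_pos.2 h).ne')
  refine ⟨happ'.toOpenPartialHomeomorph G₀ (s ∩ R) hc (hs.inter hR), ⟨hx₀s, e, he⟩,
    ⟨hG₀.contDiffOn, ?_, ?_⟩, fun z j => congrFun (hcl j) z⟩
  · intro a ha
    have hmem := (happ'.toOpenPartialHomeomorph G₀ (s ∩ R) hc (hs.inter hR)).map_target ha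
    obtain ⟨e', he'⟩ := hmem.2
    refine (OpenPartialHomeomorph.contDiffAt_symm _ (f₀' := e') ha ?_
      hG₀.contDiffAt).contDiffWithinAt
    rw [he']
    exact (hG₀.differentiable (by norm_num) _).hasFDerivAt
  · exact isBiLipschitzOn_of_dist_le _ _
      (fun x hx y hy => happ'.lipschitz.dist_le_mul ⟨x, hx⟩ ⟨y, hy⟩)
      (fun x hx y hy => (happ'.antilipschitz hc).le_mul_dist ⟨x, hx⟩ ⟨y, hy⟩)

end InverseFunction

end MetricIFT

/-! ### Choice of the distance functions and proof of the theorem. -/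

namespace MetricIFT

/-- The distances to a dense sequence of image points, extended to Lipschitz functions, control the
distances between image points. -/
lemma exists_lipschitz_distance_functions {E X : Type*} [MetricSpace E]
    [SecondCountableTopology E] [MetricSpace X] {A : Set E} (hA : A.Nonempty) {f : E → X} {L : ℝ≥0}
    (hf : LipschitzOnWith L f A) :
    ∃ (p : ℕ → X) (φ : ℕ → E → ℝ), (∀ i, LipschitzWith L (φ i)) ∧
      (∀ i, ∀ y ∈ A, φ i y = dist (f y) (p i)) ∧
      ∀ y ∈ A, ∀ z ∈ A, ∀ c, (∀ i, |φ i y - φ i z| ≤ c) → dist (f y) (f z) ≤ c := by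
  have : Nonempty A := hA.to_subtype
  let a : ℕ → A := TopologicalSpace.denseSeq A
  have hLip : ∀ i, LipschitzOnWith L (fun y => dist (f y) (f (a i))) A := by
    intro i
    have h := (LipschitzWith.dist_left (f (a i))).comp_lipschitzOnWith hf
    rw [one_mul] at h
    exact h
  choose φ hφ hφeq using fun i => (hLip i).extend_real
  refine ⟨fun i => f (a i), φ, hφ, fun i y hy => (hφeq i hy).symm, fun y hy z hz c h => ?_⟩
  refine le_of_forall_pos_le_add fun ε hε => ?_
  -- With `a i` near `z`, the triangle inequality through `f (a i)` gives `c` plus twice `dist (f z)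
  -- (f (a i))`, and the latter is below `ε / 2`.
  obtain ⟨i, hi⟩ := Metric.denseRange_iff.1 (TopologicalSpace.denseRange_denseSeq A) ⟨z, hz⟩
    (ε / (2 * (L + 1))) (by positivity)
  have hi' : dist z (a i) * (2 * (L + 1)) < ε := by
    rw [lt_div_iff₀ (by positivity)] at hi
    exact hi
  have h1 := h i
  rw [← hφeq i hy, ← hφeq i hz] at h1
  have h2 := hf.dist_le_mul z hz (a i) (a i).2
  have h3 := dist_triangle_right (f y) (f z) (f (a i))
  have h4 := (abs_le.1 h1).2
  nlinarith [dist_nonneg (x := z) (y := (a i : E)), L.2]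

/-- There are countably many `n`-tuples of indices, and their good sets cover almost all points of
positive density, so one of them has positive measure. -/
lemma exists_tuple_linearIndependent_of_upperDensity_pos {X : Type*} [MetricSpace X] {k n : ℕ}
    {A : Set (EuclideanSpace ℝ (Fin k))} (hA : NullMeasurableSet A volume)
    {f : EuclideanSpace ℝ (Fin k) → X}
    {φ : ℕ → EuclideanSpace ℝ (Fin k) → ℝ} {L : ℝ≥0} (hφ : ∀ i, LipschitzWith L (φ i))
    (hdist : ∀ y ∈ A, ∀ z ∈ A, ∀ c, (∀ i, |φ i y - φ i z| ≤ c) → dist (f y) (f z) ≤ c)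
    (hdens : 0 < volume {x ∈ A | 0 < upperDensity n A f x}) :
    ∃ (I : Fin n → ℕ) (B : Set (EuclideanSpace ℝ (Fin k))), B ⊆ A ∧ MeasurableSet B ∧
      0 < volume B ∧ (∀ x ∈ B, ∀ j, DifferentiableAt ℝ (φ (I j)) x) ∧
      ∀ x ∈ B, LinearIndependent ℝ fun j => fderiv ℝ (φ (I j)) x := by
  obtain ⟨A', hA'A, hA'm, hA'e⟩ := hA.exists_measurable_subset_ae_eq
  let B : (Fin n → ℕ) → Set (EuclideanSpace ℝ (Fin k)) := fun I =>
    A' ∩ ((⋂ j, {x | DifferentiableAt ℝ (φ (I j)) x}) ∩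
      {x | LinearIndependent ℝ fun j => fderiv ℝ (φ (I j)) x})
  have hBm : ∀ I, MeasurableSet (B I) := by
    intro I
    refine hA'm.inter ((MeasurableSet.iInter fun j => measurableSet_of_differentiableAt ℝ _).inter ?_)
    have hmeas : Measurable fun x => fun j => fderiv ℝ (φ (I j)) x :=
      measurable_pi_lambda _ fun j => measurable_fderiv ℝ (φ (I j))
    exact hmeas isOpen_setOfPred_linearIndependent.measurableSet
  have hex : ∃ I, 0 < volume (B I) := by
    by_contra! hall
    have hnull : volume (⋃ I, B I) = 0 :=
      measure_iUnion_null fun I => le_antisymm (hall I) bot_le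
    refine hdens.ne' ?_
    have hdiff : ∀ᵐ x, ∀ i, DifferentiableAt ℝ (φ i) x :=
      ae_all_iff.2 fun i => (hφ i).ae_differentiableAt
    rw [measure_eq_zero_iff_ae_notMem] at hnull ⊢
    filter_upwards [hnull, hdiff, hA'e.mem_iff,
      ae_exists_linearIndependent_fderiv (n := n) hφ hdist] with x hx hxd hxA hxI hxmem
    obtain ⟨I, hI⟩ := hxI hxmem.2
    exact hx (mem_iUnion.2 ⟨I, hxA.2 hxmem.1, mem_iInter.2 fun j => hxd _, hI⟩)
  obtain ⟨I, hI⟩ := hex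
  exact ⟨I, B I, inter_subset_left.trans hA'A, hBm I, hI,
    fun x hx j => mem_iInter.1 hx.2.1 j, fun x hx => hx.2.2⟩

/-- The `C¹` Lusin property for finitely many functions. -/
theorem exists_contDiff_eqOn_of_differentiableAt {E : Type*} [NormedAddCommGroup E]
    [InnerProductSpace ℝ E] [FiniteDimensional ℝ E] [MeasurableSpace E] [BorelSpace E] {n : ℕ}
    {φ : Fin n → E → ℝ} (hφ : ∀ j, Continuous (φ j)) {B : Set E} (hB : MeasurableSet B)
    (hBpos : 0 < volume B) (hd : ∀ x ∈ B, ∀ j, DifferentiableAt ℝ (φ j) x) :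
    ∃ K ⊆ B, MeasurableSet K ∧ 0 < volume K ∧
      ∃ ψ : Fin n → E → ℝ, (∀ j, ContDiff ℝ 1 (ψ j)) ∧ ∀ j, EqOn (ψ j) (φ j) K := by
  -- Egorov is applied to the vector-valued map, so that one set serves all components.
  obtain ⟨K, hKB, hK, hKpos, hKd⟩ := exists_uniformlyDifferentiableOn_subset
    (Φ := fun x j => φ j x) (continuous_pi hφ) hB hBpos fun x hx => differentiableAt_pi.2 (hd x hx)
  have hj : ∀ j, UniformlyDifferentiableOn (φ j)
      (fun x => (ContinuousLinearMap.proj j).comp (fderiv ℝ (fun x j => φ j x) x)) K := by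
    intro j ε hε
    obtain ⟨δ, hδ, h⟩ := hKd ε hε
    exact ⟨δ, hδ, fun x hx y hy => (norm_le_pi_norm _ j).trans (h x hx y hy)⟩
  choose ψ hψ hψe using fun j => (hj j).exists_contDiff_eqOn (hφ j)
  exact ⟨K, hKB, hK, hKpos, ψ, hψ, hψe⟩

end MetricIFT

theorem theorem1p1 {X : Type*} [MetricSpace X] [MeasurableSpace X] [BorelSpace X] {n m : ℕ}
    (A : Set (EuclideanSpace ℝ (Fin (n + m)))) (hA : NullMeasurableSet A volume)
    (hApos : 0 < volume A)
    (f : EuclideanSpace ℝ (Fin (n + m)) → X) (hf : ∃ L : ℝ≥0, LipschitzOnWith L f A)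
    (hdens : 0 < volume {x ∈ A | 0 < MetricIFT.upperDensity n A f x}) :
    0 < MetricIFT.normalizedHausdorff n (f '' A) ∧
    ∃ (K : Set (EuclideanSpace ℝ (Fin (n + m))))
      (G : OpenPartialHomeomorph (EuclideanSpace ℝ (Fin (n + m)))
        (EuclideanSpace ℝ (Fin (n + m))))
      (π : X → EuclideanSpace ℝ (Fin n)),
      K ⊆ A ∧ NullMeasurableSet K volume ∧ 0 < volume K ∧
      K ⊆ G.source ∧ MetricIFT.IsBiLipschitzC1Diffeo G ∧
      LipschitzWith (NNReal.sqrt (n : ℝ≥0)) π ∧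
      (∀ z ∈ G '' K, (π ∘ f ∘ G.symm) z = MetricIFT.projFirst z) ∧
      (∀ z ∈ G '' K, (f ∘ G.symm) ⁻¹' {(f ∘ G.symm) z} ∩ G '' K ⊆
        {w | MetricIFT.projFirst w = MetricIFT.projFirst z}) ∧
      (∀ y : EuclideanSpace ℝ (Fin m),
        MetricIFT.IsBiLipschitzOn (f ∘ G.symm) ({z | MetricIFT.projLast z = y} ∩ G '' K)) := by
  open MetricIFT in
  obtain ⟨L, hL⟩ := hf
  obtain ⟨p, φ, hφ, hφA, hdist⟩ :=
    exists_lipschitz_distance_functions (nonempty_of_measure_ne_zero hApos.ne') hL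
  obtain ⟨I, B, hBA, hB, hBpos, hBd, hBli⟩ :=
    exists_tuple_linearIndependent_of_upperDensity_pos hA hφ hdist hdens
  obtain ⟨K₁, hK₁B, hK₁, hK₁pos, ψ, hψ, hψφ⟩ :=
    exists_contDiff_eqOn_of_differentiableAt (fun j => (hφ (I j)).continuous) hB hBpos hBd
  have hfd : ∀ᵐ x ∂volume.restrict K₁, ∀ j, fderiv ℝ (ψ j) x = fderiv ℝ (φ (I j)) x :=
    ae_all_iff.2 fun j => ae_fderiv_eq_of_eqOn volume hK₁ (fun x hx => hBd x (hK₁B hx) j)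
      (fun x _ => (hψ j).differentiable (by norm_num) x) (hψφ j)
  rw [ae_restrict_iff' hK₁] at hfd
  have hgood : volume (K₁ ∩ {x | ∀ j, fderiv ℝ (ψ j) x = fderiv ℝ (φ (I j)) x}) ≠ 0 := by
    refine fun h0 => hK₁pos.ne' ?_
    rw [measure_eq_zero_iff_ae_notMem] at h0 ⊢
    filter_upwards [h0, hfd] with x hx hxd hxK using hx ⟨hxK, hxd hxK⟩
  -- Every neighbourhood of `x₀` meets the good set in positive measure, so `K₁` cut down to the
  -- domain of `G` keeps positive measure.
  obtain ⟨x₀, ⟨hx₀K, hx₀d⟩, hx₀⟩ := exists_mem_forall_mem_nhdsWithin_pos_measure hgood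
  obtain ⟨G, hx₀G, hG, hGψ⟩ := exists_isBiLipschitzC1Diffeo (m := m) hψ (x₀ := x₀) (by
    simpa only [hx₀d _] using hBli x₀ (hK₁B hx₀K))
  set K := K₁ ∩ G.source
  have hKpos : 0 < volume K := by
    refine (hx₀ _ (inter_mem_nhdsWithin _ (G.open_source.mem_nhds hx₀G))).trans_le
      (measure_mono ?_)
    exact inter_subset_inter_left _ inter_subset_left
  have hKA : K ⊆ A := inter_subset_left.trans (hK₁B.trans hBA)
  have hKG : K ⊆ G.source := inter_subset_right
  let π : X → EuclideanSpace ℝ (Fin n) := fun q => WithLp.toLp 2 fun j => dist q (p (I j))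
  have hπ : LipschitzWith (NNReal.sqrt (n : ℝ≥0)) π :=
    lipschitzWith_sqrt_toLp fun j => LipschitzWith.dist_left (p (I j))
  have hπf : ∀ x ∈ K, π (f x) = projFirst (G x) := by
    intro x hx
    ext j
    change dist (f x) (p (I j)) = G x (Fin.castAdd m j)
    rw [hGψ, hψφ j hx.1, hφA _ x (hKA hx)]
  have hproj : ∀ z ∈ G '' K, (π ∘ f ∘ G.symm) z = projFirst z := by
    rintro _ ⟨x, hx, rfl⟩
    simp only [Function.comp_apply, G.left_inv (hKG hx)]
    exact hπf x hx
  refine ⟨?_, K, G, π, hKA, (hK₁.inter G.open_source.measurableSet).nullMeasurableSet, hKpos, hKG,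
    hG, hπ, hproj, ?_, ?_⟩
  · have hGK : 0 < volume (G '' K) := by
      refine pos_iff_ne_zero.2 fun h0 => hKpos.ne' ?_
      -- The differentiable map `G.symm` preserves null sets, so `G '' K` cannot be null.
      have h1 := addHaar_image_eq_zero_of_differentiableOn_of_addHaar_eq_zero volume
        (f := G.symm) ((hG.2.1.differentiableOn (by norm_num)).mono
          (image_subset_iff.2 fun x hx => G.map_source (hKG hx))) h0
      have hsub : K ⊆ G.symm '' (G '' K) := fun x hx =>
        ⟨G x, mem_image_of_mem _ hx, G.left_inv (hKG hx)⟩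
      exact measure_mono_null hsub h1
    have himg : projFirst '' (G '' K) ⊆ π '' (f '' A) := by
      rintro _ ⟨_, ⟨x, hx, rfl⟩, rfl⟩
      exact ⟨f x, mem_image_of_mem f (hKA hx), hπf x hx⟩
    have hH := hausdorffMeasure_pos_of_volume_image_pos hπ
      ((volume_image_projFirst_pos hGK).trans_le (measure_mono himg))
    exact ENNReal.mul_pos (ENNReal.div_ne_zero.2 ⟨(unitBallVolume_pos n).ne', by finiteness⟩) hH.ne'
  · rintro z hz w ⟨hwz, hw⟩
    have hwz : (f ∘ G.symm) w = (f ∘ G.symm) z := hwz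
    have h1 : π ((f ∘ G.symm) w) = π ((f ∘ G.symm) z) := by rw [hwz]
    exact (hproj w hw).symm.trans (h1.trans (hproj z hz))
  · intro y
    obtain ⟨Λ, hΛ, hbi⟩ := hG.2.2
    -- The lower bound comes from `π`: on a slice, distances are those of the first coordinates,
    -- which `π` recovers. Neither constant depends on `y`.
    refine isBiLipschitzOn_of_dist_le (L * Λ) (NNReal.sqrt (n : ℝ≥0)) ?_ ?_
    · rintro _ ⟨-, x, hx, rfl⟩ _ ⟨-, x', hx', rfl⟩
      simp only [Function.comp_apply, G.left_inv (hKG hx), G.left_inv (hKG hx')]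
      have h1 := hL.dist_le_mul x (hKA hx) x' (hKA hx')
      have h2 := (hbi x (hKG hx) x' (hKG hx')).1
      rw [inv_mul_le_iff₀ hΛ] at h2
      rw [mul_assoc]
      exact h1.trans (mul_le_mul_of_nonneg_left h2 L.2)
    · rintro z ⟨hzy, hz⟩ w ⟨hwy, hw⟩
      have hzw : projLast z = projLast w := hzy.trans hwy.symm
      rw [dist_eq_dist_projFirst hzw, ← hproj z hz, ← hproj w hw]
      exact hπ.dist_le_mul _ _
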